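/- **Setting.** Let $H$ be a (separable) complex Hilbert space with inner product $\langle\cdot,\cdot\rangle$ linear in the first variable. A sequence $E=(e_n)_{n\ge1}$ in $H$ is a *frame* for $H$ if there are $A,B>0$ with $A\|f\|^2\le\sum_n|\langle f,e_n\rangle|^2\le B\|f\|^2$ for all $f\in H$; then $S_Ef=\sum_n\langle f,e_n\rangle e_n$ is a bounded bijection of $H$, and $\widetilde E=(\widetilde{e_n})_{n\ge1}:=(S_E^{-1}e_n)_{n\ge1}$ is the *canonical dual* of $E$. A *Riesz basis* for $H$ is the image of an orthonormal basis $(b_n)_{n\ge1}$ of $H$ under a bounded bijective operator on $H$. Let $G=(g_n)_{n\ge1}$ be a Riesz basis for $H$ with canonical dual $(\widetilde{g_n})_{n\ge1}$. A frame $E$ is, with respect to $G$, - *$s$-localized* ($s>0$) if for some $C>0$: $\max\{|\langle e_m,g_n\rangle|,|\langle e_m,\widetilde{g_n}\rangle|\}\le C(1+|m-n|)^{-s}$ for all $m,n\ge1$; - *$\beta$-sub-exponentially localized* ($0<\beta<1$), resp. *exponentially localized*, if for some $\gamma,C>0$ the same maximum is at most $Ce^{-\gamma|m-n|^{\beta}}$,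 resp. $Ce^{-\gamma|m-n|}$, for all $m,n\ge1$. A positive continuous function $\mu$ on $\mathbb R$ is a *$k$-moderate weight* ($k\ge0$) if $\mu(t+x)\le C(1+|t|)^k\mu(x)$ for some $C>0$ and all $t,x\in\mathbb R$, and a *$\beta$-sub-exponential weight* ($0<\beta<1$) if $\mu(t+x)\le Ce^{\gamma|t|^\beta}\mu(x)$ for some $C,\gamma>0$ and all $t,x\in\mathbb R$. Let $(\mu_k)_{k\ge0}$ be weights with $1=\mu_0(x)\le\mu_1(x)\le\mu_2(x)\le\cdots$ for all $x\in\mathbb R$. Put $$\Theta_k:=\ell^2_{\mu_k}=\Big\{(a_n)_{n\ge1}:\ \|(a_n)\|_{\Theta_k}:=\Big(\sum_{n\ge1}|a_n|^2\mu_k(n)^2\Big)^{1/2}<\infty\Big\},$$ $$X_k:=\{f\in H:\ (\langle f,\widetilde{g_n}\rangle)_n\in\Theta_k\},\qquad \|f\|_k:=\|(\langle f,\widetilde{g_n}\rangle)_n\|_{\Theta_k},$$ and $\Theta_F:=\bigcap_k\Theta_k$, $X_F:=\bigcap_kX_k$ with the projective limit topologies (given by the norms $\|\cdot\|_{\Theta_k}$,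 resp. $\|\cdot\|_k$, $k\ge0$). Duals $X_F^*$, $\Theta_F^*$ are the spaces of continuous linear functionals, $X_F^*$ with the topology of uniform convergence on bounded sets; $\Theta_F^*$ is identified with the sequence space $\{(U\delta_n)_n: U\in\Theta_F^*\}$, $\delta_n$ the canonical vectors. As an element of $X_F^*$, a vector $h\in H$ is the functional $f\mapsto\langle f,h\rangle$. A linear map between two of these projective limits is *$F$-bounded* if for every $k$ it satisfies an estimate $\|Ty\|_k\le C_k\|y\|_k$. For $Y=X$ or $Y=\Theta$ call the following the *standing conditions*: every $Y_k$ is a separable Banach space, $\{0\}\ne Y_F\subseteq\cdots\subseteq Y_1\subseteq Y_0$, the norms are non-decreasing in $k$, and $Y_F$ is dense in every $Y_k$. A sequence $(\phi_n)$ in $X_F^*$ is a *Fréchet frame* for $X_F$ with respect to $\Theta_F$ if $(X_k)$ and $(\Theta_k)$ satisfy the standing conditions, the coordinate functionals on every $\Theta_k$ are continuous, $(\phi_n(f))_n\in\Theta_F$ for all $f\in X_F$, for every $k$ there are $0<A_k\le B_k<\infty$ with $A_k\|f\|_k\le\|(\phi_n(f))_n\|_{\Theta_k}\le B_k\|f\|_k$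 for all $f\in X_F$, and there is an $F$-bounded operator $V:\Theta_F\to X_F$ with $V(\phi_n(f))_n=f$ for all $f\in X_F$. **Theorem.** Let $E=(e_n)_{n\ge1}$ be a sequence in $X_F$ which is a frame for $H$. Assume that one of the following holds: - for every $k\ge0$, $\mu_k$ is a $\beta_k$-sub-exponential weight ($0<\beta_k<1$), and $E$ is either $\beta$-sub-exponentially localized with respect to $G$ for some $\beta\in(0,1)$ with $\beta>\beta_k$ for all $k$, or exponentially localized with respect to $G$; - for every $k\ge0$, $\mu_k$ is a $k$-moderate weight, and $E$ is $s$-localized with respect to $G$ for every $s\in\mathbb N$, $s\geq 1$. Then $\widetilde{e_n}\in X_F$ for every $n$, and the following hold. (i) The analysis operator $U_Ef=(\langle f,e_n\rangle)_n$ is $F$-bounded from $X_F$ into $\Theta_F$; the synthesis operator $T_E(c_n)=\sum_nc_ne_n$ (series converging in $X_F$) is $F$-bounded from $\Theta_F$ into $X_F$; the frame operator $S_E=T_EU_E$ is $F$-bounded and bijective from $X_F$ onto $X_F$, and the series $S_Ef=\sum_n\langle f,e_n\rangle e_n$ converges unconditionally in $X_F$ for every $f\in X_F$. (ii) For every $f\in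 X_F$, $f=\sum_n\langle f,\widetilde{e_n}\rangle e_n=\sum_n\langle f,e_n\rangle\widetilde{e_n}$ with convergence in $X_F$, and $(\langle f,\widetilde{e_n}\rangle)_n,(\langle f,e_n\rangle)_n\in\Theta_F$. (iii) For a sequence $(d_n)$ in $H$ let $\mathcal P_{(d_n)}$ be the property: for $f\in H$, one has $f\in X_F$ if and only if $(\langle f,d_n\rangle)_n\in\Theta_F$. If $\mathcal P_{(g_n)}$ holds, then $\mathcal P_{(e_n)}$ and $\mathcal P_{(\widetilde{e_n})}$ hold. (iv) Both $(e_n)$ and $(\widetilde{e_n})$, regarded as sequences in $X_F^*$, are Fréchet frames for $X_F$ with respect to $\Theta_F$. (v) For every $g\in X_F^*$, $g=\sum_ng(e_n)\,\widetilde{e_n}=\sum_ng(\widetilde{e_n})\,e_n$ with convergence in $X_F^*$, and $(g(e_n))_n,(g(\widetilde{e_n}))_n\in\Theta_F^*$. (vi) If $(a_n)_n\in\Theta_F^*$, then $\sum_na_ne_n$ and $\sum_na_n\widetilde{e_n}$ converge in $X_F^*$; that is, $f\mapsto\sum_n\langle f,e_n\rangle a_n$ and $f\mapsto\sum_n\langle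 f,\widetilde{e_n}\rangle a_n$ are continuous linear functionals on $X_F$ and are the sums of these series. -/

import Mathlib

open Filter Topology

noncomputable section

/-! ### Frames in a Hilbert space

All sequences `(x_n)_{n ≥ 1}` are indexed by `ℕ`, the entry at `n : ℕ` being `x_{n+1}`.  The pairing
`⟨f, h⟩`, linear in `f`, is Mathlib's `inner ℂ h f`. -/

section Frames

variable {H : Type*} [NormedAddCommGroup H] [InnerProductSpace ℂ H]

/-- `e` is a frame for `H`. -/
def IsFrame (e : ℕ → H) : Prop :=
  ∃ A B : ℝ, 0 < A ∧ 0 < B ∧ ∀ f : H, Summable (fun n => ‖inner ℂ (e n) f‖ ^ 2) ∧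
    A * ‖f‖ ^ 2 ≤ ∑' n, ‖inner ℂ (e n) f‖ ^ 2 ∧ ∑' n, ‖inner ℂ (e n) f‖ ^ 2 ≤ B * ‖f‖ ^ 2

/-- `g` is a Riesz basis for `H`: the image of an orthonormal basis under a bounded bijective
operator on `H`. -/
def IsRieszBasis (g : ℕ → H) : Prop :=
  ∃ (b : HilbertBasis ℕ ℂ H) (Q : H →L[ℂ] H), Function.Bijective Q ∧ ∀ n, g n = Q (b n)

/-- The frame operator `S_E f = ∑ ⟨f, e_n⟩ e_n` on `H`.  When `e` is a frame, the series converges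
unconditionally for every `f`, and `frameOperator e` is a bijection of `H`. -/
def frameOperator (e : ℕ → H) (f : H) : H := ∑' n, inner ℂ (e n) f • e n

/-- The canonical dual `(S_E⁻¹ e_n)` of a frame `e`. -/
def canonicalDual (e : ℕ → H) (n : ℕ) : H := Function.invFun (frameOperator e) (e n)

/-- The sequence of coefficients `f ↦ (⟨f, d_n⟩)_n`, as a linear map. -/
def coeffMap (d : ℕ → H) : H →ₗ[ℂ] (ℕ → ℂ) where
  toFun f n := inner ℂ (d n) f
  map_add' f h := by ext n; simp
  map_smul' c f := by ext n; simp

/-- `e` is polynomially localized with respect to `g` with decay `γ`. -/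
def IsPolyLocalized (e g : ℕ → H) (γ : ℝ) : Prop :=
  ∃ C : ℝ, 0 < C ∧ ∀ m n : ℕ,
    max ‖inner ℂ (g n) (e m)‖ ‖inner ℂ (canonicalDual g n) (e m)‖ ≤
      C * (1 + |(m : ℝ) - n|) ^ (-γ)

/-- `e` is `β`-sub-exponentially localized with respect to `g`. -/
def IsSubExpLocalized (e g : ℕ → H) (β : ℝ) : Prop :=
  ∃ γ C : ℝ, 0 < γ ∧ 0 < C ∧ ∀ m n : ℕ,
    max ‖inner ℂ (g n) (e m)‖ ‖inner ℂ (canonicalDual g n) (e m)‖ ≤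
      C * Real.exp (-(γ * |(m : ℝ) - n| ^ β))

/-- `e` is exponentially localized with respect to `g`. -/
def IsExpLocalized (e g : ℕ → H) : Prop :=
  ∃ γ C : ℝ, 0 < γ ∧ 0 < C ∧ ∀ m n : ℕ,
    max ‖inner ℂ (g n) (e m)‖ ‖inner ℂ (canonicalDual g n) (e m)‖ ≤
      C * Real.exp (-(γ * |(m : ℝ) - n|))

end Frames

/-! ### Weights -/

/-- `μ` is a `k`-moderate weight on `ℝ`. -/
def IsModerateWeight (k : ℝ) (μ : ℝ → ℝ) : Prop :=
  0 ≤ k ∧ Continuous μ ∧ (∀ x, 0 < μ x) ∧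
    ∃ C : ℝ, 0 < C ∧ ∀ t x : ℝ, μ (t + x) ≤ C * (1 + |t|) ^ k * μ x

/-- `μ` is a `β`-sub-exponential weight on `ℝ`. -/
def IsSubExpWeight (β : ℝ) (μ : ℝ → ℝ) : Prop :=
  0 < β ∧ β < 1 ∧ Continuous μ ∧ (∀ x, 0 < μ x) ∧
    ∃ C γ : ℝ, 0 < C ∧ 0 < γ ∧ ∀ t x : ℝ, μ (t + x) ≤ C * Real.exp (γ * |t| ^ β) * μ x

/-! ### Sequences of normed spaces and their projective limits -/

/-- A sequence `(Y_k, |·|_k)` of subspaces of a vector space, each with a seminorm of its own. -/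
structure NormedChain (V : Type*) [AddCommGroup V] [Module ℂ V] where
  /-- The space `Y_k`. -/
  space : ℕ → Submodule ℂ V
  /-- The (semi)norm `|·|_k` on `Y_k`. -/
  nrm : ∀ k, Seminorm ℂ (space k)

namespace NormedChain

variable {V W : Type*} [AddCommGroup V] [Module ℂ V] [AddCommGroup W] [Module ℂ W]

/-- The intersection `Y_F = ⋂ k, Y_k`, as a subspace. -/
def inter (Y : NormedChain V) : Submodule ℂ V := ⨅ k, Y.space k

/-- The projective limit `Y_F = ⋂ k, Y_k`; it carries the topology given by the norms `|·|_k`. -/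
def Lim (Y : NormedChain V) : Type _ := ↥Y.inter

variable (Y : NormedChain V)

instance : AddCommGroup Y.Lim := inferInstanceAs (AddCommGroup ↥Y.inter)

instance : Module ℂ Y.Lim := inferInstanceAs (Module ℂ ↥Y.inter)

/-- The inclusion of `Y_F` into the ambient space. -/
def incl : Y.Lim →ₗ[ℂ] V := Y.inter.subtype

/-- The inclusion of `Y_F` into `Y_k`. -/
def toSpace (k : ℕ) : Y.Lim →ₗ[ℂ] Y.space k := Submodule.inclusion (iInf_le Y.space k)

/-- The norms `|·|_k` on `Y_F`. -/
def limNorm : SeminormFamily ℂ Y.Lim ℕ := fun k => (Y.nrm k).comp (Y.toSpace k)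

instance : TopologicalSpace Y.Lim := Y.limNorm.moduleFilterBasis.topology

/-- The norms `|·|_k` define the topology of `Y_F`. -/
theorem withSeminorms : WithSeminorms Y.limNorm := ⟨rfl⟩

instance : IsTopologicalAddGroup Y.Lim := Y.withSeminorms.topologicalAddGroup

instance : ContinuousSMul ℂ Y.Lim := Y.withSeminorms.continuousSMul

/-- The standing conditions on the sequence: every `(Y_k, |·|_k)` is a separable Banach space,
`{0} ≠ ⋂ k, Y_k ⊆ … ⊆ Y_1 ⊆ Y_0`, `|·|_0 ≤ |·|_1 ≤ …`, and `Y_F` is dense in every `Y_k`. -/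
structure IsFrechetChain (Y : NormedChain V) : Prop where
  definite : ∀ k (y : Y.space k), Y.nrm k y = 0 → y = 0
  complete : ∀ k (u : ℕ → Y.space k),
    (∀ ε > 0, ∃ N, ∀ m ≥ N, ∀ n ≥ N, Y.nrm k (u m - u n) < ε) →
      ∃ y, Tendsto (fun n => Y.nrm k (u n - y)) atTop (𝓝 0)
  separable : ∀ k, ∃ D : Set (Y.space k), D.Countable ∧
    ∀ y, ∀ ε > 0, ∃ d ∈ D, Y.nrm k (y - d) < ε
  nontrivial : Y.inter ≠ ⊥
  space_le : ∀ k, Y.space (k + 1) ≤ Y.space k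
  nrm_le : ∀ k (y : Y.space (k + 1)), Y.nrm k ⟨y, space_le k y.2⟩ ≤ Y.nrm (k + 1) y
  dense : ∀ k (y : Y.space k), ∀ ε > 0, ∃ z : Y.Lim, Y.nrm k (y - Y.toSpace k z) < ε

/-- The spaces of a sequence of sequence spaces are `BK`-spaces, as far as the continuity of the
coordinate functionals is concerned. -/
def IsBK (Θ : NormedChain (ℕ → ℂ)) : Prop :=
  ∀ k n, ∃ C : ℝ, ∀ c : Θ.space k, ‖(c : ℕ → ℂ) n‖ ≤ C * Θ.nrm k c

/-- The spaces `{f : L f ∈ Y_k}` with the norms `|L f|_k`. -/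
def pullback (Y : NormedChain W) (L : V →ₗ[ℂ] W) : NormedChain V where
  space k := (Y.space k).comap L
  nrm k := (Y.nrm k).comp (L.restrict fun _ hx => hx)

end NormedChain

/-- `F`-boundedness of an operator between projective limits. -/
def IsFBounded {V W : Type*} [AddCommGroup V] [Module ℂ V] [AddCommGroup W] [Module ℂ W]
    {Y : NormedChain V} {Z : NormedChain W} (T : Y.Lim →ₗ[ℂ] Z.Lim) : Prop :=
  ∀ k, ∃ C : ℝ, 0 < C ∧ ∀ y, Z.limNorm k (T y) ≤ C * Y.limNorm k y

/-- `(φ_n)` is a Fréchet frame (`F`-frame) for `X_F` with respect to `Θ_F`. -/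
def IsFrechetFrame {V : Type*} [AddCommGroup V] [Module ℂ V] (X : NormedChain V)
    (Θ : NormedChain (ℕ → ℂ)) (φ : ℕ → X.Lim →L[ℂ] ℂ) : Prop :=
  X.IsFrechetChain ∧ Θ.IsFrechetChain ∧ Θ.IsBK ∧
    ∃ hΘ : ∀ f : X.Lim, (fun n => φ n f) ∈ Θ.inter,
      (∀ k, ∃ A B : ℝ, 0 < A ∧ A ≤ B ∧ ∀ f : X.Lim,
        A * X.limNorm k f ≤ Θ.limNorm k ⟨fun n => φ n f, hΘ f⟩ ∧
        Θ.limNorm k ⟨fun n => φ n f, hΘ f⟩ ≤ B * X.limNorm k f) ∧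
      ∃ R : Θ.Lim →ₗ[ℂ] X.Lim, IsFBounded R ∧ ∀ f : X.Lim, R ⟨fun n => φ n f, hΘ f⟩ = f

/-- The sequence `a` belongs to the dual `Θ_F^*`, identified with the space of all sequences
`(U δ_n)_n`, where `U` is a continuous linear functional on `Θ_F` and `δ_n` is the `n`-th canonical
vector. -/
def MemDual (Θ : NormedChain (ℕ → ℂ)) (a : ℕ → ℂ) : Prop :=
  ∃ U : Θ.Lim →L[ℂ] ℂ, ∀ n, ∃ hδ : Pi.single n 1 ∈ Θ.inter, a n = U ⟨Pi.single n 1, hδ⟩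

/-- The series `∑ u_n` converges to `x` (convergence of the partial sums). -/
def SeriesTo {M : Type*} [AddCommMonoid M] [TopologicalSpace M] (u : ℕ → M) (x : M) : Prop :=
  Tendsto (fun N => ∑ n ∈ Finset.range N, u n) atTop (𝓝 x)

/-! ### The concrete spaces -/

/-- The space of all sequences `a` with `(w_n a_n)_n ∈ ℓ²`. -/
def weightedL2 (w : ℕ → ℝ) : Submodule ℂ (ℕ → ℂ) where
  carrier := {a | Memℓp (fun n => (w n : ℂ) * a n) 2}
  zero_mem' := by
    have h : Memℓp (0 : ∀ _ : ℕ, ℂ) 2 := zero_memℓp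
    simpa [Pi.zero_def] using h
  add_mem' {a b} ha hb := by
    have h := Memℓp.add ha hb
    simpa [mul_add, Pi.add_def] using h
  smul_mem' c a ha := by
    have h := Memℓp.const_smul ha c
    simpa [Pi.smul_def, mul_left_comm] using h

/-- The map `a ↦ (w_n a_n)_n` from `weightedL2 w` to `ℓ²`. -/
def weightedL2ToLp (w : ℕ → ℝ) : weightedL2 w →ₗ[ℂ] lp (fun _ : ℕ => ℂ) 2 where
  toFun a := ⟨fun n => (w n : ℂ) * (a : ℕ → ℂ) n, a.2⟩
  map_add' a b := by ext n; exact mul_add _ _ _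
  map_smul' c a := by ext n; simp [mul_left_comm]

/-- The spaces `Θ_k = ℓ²_{μ_k}`, with the norms `(∑_{n ≥ 1} |a_n|² μ_k(n)²)^{1/2}`. -/
def thetaChain (μ : ℕ → ℝ → ℝ) : NormedChain (ℕ → ℂ) where
  space k := weightedL2 fun n => μ k (n + 1)
  nrm k := (normSeminorm ℂ (lp (fun _ : ℕ => ℂ) 2)).comp (weightedL2ToLp fun n => μ k (n + 1))

/-- The spaces `X_k`: all `f ∈ H` with `(⟨f, g̃_n⟩)_n ∈ Θ_k`, where `g̃` is the canonical dual of `g`,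
normed by `‖f‖_k = ‖(⟨f, g̃_n⟩)_n‖_{Θ_k}`. -/
def xChain {H : Type*} [NormedAddCommGroup H] [InnerProductSpace ℂ H]
    (g : ℕ → H) (μ : ℕ → ℝ → ℝ) : NormedChain H :=
  (thetaChain μ).pullback (coeffMap (canonicalDual g))

/-- The property `𝒫_(d_n)` of `X_F` and `Θ_F`: an `f ∈ H` is in `X_F` if and only if
`(⟨f, d_n⟩)_n ∈ Θ_F`. -/
def HasPropertyP {H : Type*} [NormedAddCommGroup H] [InnerProductSpace ℂ H]
    (X : NormedChain H) (Θ : NormedChain (ℕ → ℂ)) (d : ℕ → H) : Prop :=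
  ∀ f : H, f ∈ X.inter ↔ coeffMap d f ∈ Θ.inter

end

/-! The coefficient map `C : f ↦ (⟨f, g̃_n⟩)_n` of the Riesz basis is an isomorphism of `H` onto
`ℓ²` that carries `X_k` isometrically onto `Θ_k`. In these coordinates analysis and synthesis for
`E` become `U C⁻¹` and `C T`, whose matrices consist of the numbers that localization controls: they
are dominated by a summable function `a(m - n)`. The whole theorem reduces to showing that these two
operators, and the inverse of the frame operator, are bounded for every weighted norm.

For the two operators this is Young's inequality `ℓ¹ * ℓ² ⊆ ℓ²`, applied to the matrix conjugated by
the weight. For the inverse no decay of the inverse matrix is proved. Instead, the weight `w` is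
replaced by an equivalent weight with `w(m) ≤ v(m - n) w(n)` and `∑ a (v - 1)` as small as desired
(`EllTwo.isSlowFor_of_family`). Multiplication by such a weight almost commutes with every matrix
dominated by `a` (`HasDecay.norm_commutator_le`), so a lower bound for the product `P R = (C T)(U
C⁻¹)` on unweighted `ℓ²` survives in the weighted norm, the commutators being absorbed
(`HasDecay.exists_bound_of_comp`). Truncating the weight makes the absorption legitimate.

The rest is formal. With `R = S⁻¹` on `X_F`, the analysis operators `U` of `E` and `U R` of the dual
frame have the left inverses `R T` and `T`. Each such pair yields a Fréchet frame and, since the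
unit vectors expand every element of `Θ_F` and their coordinate functionals expand every element of
the strong dual of `Θ_F`, all the series expansions. -/

/-! ### Matrices with off-diagonal decay on `ℓ²` -/

/-- The Hilbert space `ℓ²` of sequences indexed by `ℕ`. -/
abbrev EllTwo : Type := lp (fun _ : ℕ => ℂ) 2

namespace EllTwo

theorem hasSum_sq (y : EllTwo) : HasSum (fun n => ‖y n‖ ^ 2) (‖y‖ ^ 2) := by
  have h := lp.hasSum_norm (p := 2) (by norm_num) y
  simpa using h

theorem sum_sq_le (y : EllTwo) (s : Finset ℕ) : ∑ n ∈ s, ‖y n‖ ^ 2 ≤ ‖y‖ ^ 2 :=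
  sum_le_hasSum s (fun _ _ => by positivity) y.hasSum_sq

theorem exists_of_sum_sq_le {x : ℕ → ℂ} {B : ℝ} (hB : 0 ≤ B)
    (h : ∀ s : Finset ℕ, ∑ n ∈ s, ‖x n‖ ^ 2 ≤ B ^ 2) :
    ∃ z : EllTwo, (∀ n, z n = x n) ∧ ‖z‖ ≤ B := by
  have hx : Memℓp x 2 := memℓp_gen' (C := B ^ 2) fun s => by simpa using h s
  refine ⟨⟨x, hx⟩, fun n => rfl, ?_⟩
  refine lp.norm_le_of_forall_sum_le (by norm_num) hB fun s => ?_
  simpa using h s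

theorem exists_of_norm_le {x : ℕ → ℂ} {C : ℝ} (hC : 0 ≤ C) (y : EllTwo)
    (h : ∀ n, ‖x n‖ ≤ C * ‖y n‖) : ∃ z : EllTwo, (∀ n, z n = x n) ∧ ‖z‖ ≤ C * ‖y‖ := by
  refine exists_of_sum_sq_le (by positivity) fun s => ?_
  calc ∑ n ∈ s, ‖x n‖ ^ 2 ≤ ∑ n ∈ s, C ^ 2 * ‖y n‖ ^ 2 := by
        refine Finset.sum_le_sum fun n _ => ?_
        rw [← mul_pow]
        exact pow_le_pow_left₀ (norm_nonneg _) (h n) 2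
    _ ≤ (C * ‖y‖) ^ 2 := by
        rw [← Finset.mul_sum, mul_pow]
        exact mul_le_mul_of_nonneg_left (y.sum_sq_le s) (by positivity)

theorem norm_le_of_norm_apply_le {x y : EllTwo} {C : ℝ} (hC : 0 ≤ C)
    (h : ∀ n, ‖x n‖ ≤ C * ‖y n‖) : ‖x‖ ≤ C * ‖y‖ := by
  obtain ⟨z, hz, hn⟩ := exists_of_norm_le hC y h
  have : z = x := lp.ext (funext hz)
  rwa [← this]

theorem summable_comp_sub {α : ℤ → ℝ} (hα : Summable α) (m : ℕ) :
    Summable fun n : ℕ => α (m - n) :=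
  hα.comp_injective (i := fun n : ℕ => (m : ℤ) - n) fun a b h => by simpa using h

theorem summable_mul_norm {α : ℤ → ℝ} (h0 : ∀ t, 0 ≤ α t) (hα : Summable α) (b : EllTwo)
    (m : ℕ) : Summable fun n : ℕ => α (m - n) * ‖b n‖ :=
  ((summable_comp_sub hα m).mul_right ‖b‖).of_nonneg_of_le
    (fun n => mul_nonneg (h0 _) (norm_nonneg _))
    fun n => mul_le_mul_of_nonneg_left (lp.norm_apply_le_norm (by norm_num) b n) (h0 _)

/-- Cauchy–Schwarz for the splitting `α ‖b‖ = √α · (√α ‖b‖)`: the row half of Schur's test. -/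
theorem sq_tsum_mul_norm_le {α : ℤ → ℝ} (h0 : ∀ t, 0 ≤ α t) (hα : Summable α) (b : EllTwo)
    (m : ℕ) : Summable (fun n : ℕ => α (m - n) * ‖b n‖ ^ 2) ∧
    (∑' n : ℕ, α (m - n) * ‖b n‖) ^ 2 ≤ (∑' t, α t) * ∑' n : ℕ, α (m - n) * ‖b n‖ ^ 2 := by
  have hs := summable_comp_sub hα m
  have hs2 : Summable fun n : ℕ => α (m - n) * ‖b n‖ ^ 2 :=
    (hs.mul_right (‖b‖ ^ 2)).of_nonneg_of_le (fun n => mul_nonneg (h0 _) (by positivity))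
      fun n => mul_le_mul_of_nonneg_left
        (pow_le_pow_left₀ (norm_nonneg _) (lp.norm_apply_le_norm (by norm_num) b n) 2) (h0 _)
  refine ⟨hs2, ?_⟩
  have hle : ∑' n : ℕ, α (m - n) ≤ ∑' t, α t :=
    tsum_comp_le_tsum_of_inj hα h0 (i := fun n : ℕ => (m : ℤ) - n) fun a b h => by simpa using h
  have hK : 0 ≤ ∑' t, α t := tsum_nonneg h0
  have hcs := Real.inner_le_Lp_mul_Lq_tsum_of_nonneg (p := 2) (q := 2)
    (f := fun n : ℕ => √(α (m - n))) (g := fun n : ℕ => √(α (m - n)) * ‖b n‖)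
    (Real.holderConjugate_iff.2 ⟨by norm_num, by norm_num⟩)
    (fun _ => Real.sqrt_nonneg _) (fun _ => by positivity)
    (by simpa [Real.sq_sqrt (h0 _)] using hs)
    (by simpa [mul_pow, Real.sq_sqrt (h0 _)] using hs2)
  simp only [Real.rpow_two, mul_pow, Real.sq_sqrt (h0 _), ← mul_assoc, Real.mul_self_sqrt (h0 _),
    ← Real.sqrt_eq_rpow] at hcs
  have hB : 0 ≤ ∑' n : ℕ, α (m - n) * ‖b n‖ ^ 2 :=
    tsum_nonneg fun n => mul_nonneg (h0 _) (by positivity)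
  have hA : 0 ≤ ∑' n : ℕ, α (m - n) := tsum_nonneg fun n => h0 _
  calc (∑' n : ℕ, α (m - n) * ‖b n‖) ^ 2
      ≤ (√(∑' n : ℕ, α (m - n)) * √(∑' n : ℕ, α (m - n) * ‖b n‖ ^ 2)) ^ 2 :=
        pow_le_pow_left₀ (tsum_nonneg fun n => mul_nonneg (h0 _) (norm_nonneg _)) hcs 2
    _ = (∑' n : ℕ, α (m - n)) * ∑' n : ℕ, α (m - n) * ‖b n‖ ^ 2 := by
        rw [mul_pow, Real.sq_sqrt hA, Real.sq_sqrt hB]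
    _ ≤ _ := mul_le_mul_of_nonneg_right hle hB

/-- Young's inequality `ℓ¹ * ℓ² ⊆ ℓ²`. -/
theorem exists_of_norm_le_conv {α : ℤ → ℝ} (h0 : ∀ t, 0 ≤ α t) (hα : Summable α) (b : EllTwo)
    {x : ℕ → ℂ} (hx : ∀ m : ℕ, ‖x m‖ ≤ ∑' n : ℕ, α (m - n) * ‖b n‖) :
    ∃ z : EllTwo, (∀ n, z n = x n) ∧ ‖z‖ ≤ (∑' t, α t) * ‖b‖ := by
  have hK : 0 ≤ ∑' t, α t := tsum_nonneg h0
  refine exists_of_sum_sq_le (by positivity) fun s => ?_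
  calc ∑ m ∈ s, ‖x m‖ ^ 2
      ≤ ∑ m ∈ s, (∑' t, α t) * ∑' n : ℕ, α (m - n) * ‖b n‖ ^ 2 :=
        Finset.sum_le_sum fun m _ => (pow_le_pow_left₀ (norm_nonneg _) (hx m) 2).trans
          (sq_tsum_mul_norm_le h0 hα b m).2
    _ = (∑' t, α t) * ∑' n : ℕ, (∑ m ∈ s, α (m - n)) * ‖b n‖ ^ 2 := by
        rw [← Finset.mul_sum,
          ← Summable.tsum_finsetSum fun m _ => (sq_tsum_mul_norm_le h0 hα b m).1]
        simp_rw [Finset.sum_mul]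
    -- The column half of Schur's test: for fixed `n` the differences `m - n` are distinct.
    _ ≤ (∑' t, α t) * ∑' n : ℕ, (∑' t, α t) * ‖b n‖ ^ 2 := by
        have key (n : ℕ) : (∑ m ∈ s, α (m - n)) * ‖b n‖ ^ 2 ≤ (∑' t, α t) * ‖b n‖ ^ 2 := by
          refine mul_le_mul_of_nonneg_right ?_ (by positivity)
          have hinj : Function.Injective fun m : ℕ => (m : ℤ) - n := fun a b h => by simpa using h
          exact ((hα.comp_injective hinj).sum_le_tsum s fun _ _ => h0 _).trans
            (tsum_comp_le_tsum_of_inj hα h0 hinj)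
        have hs := b.hasSum_sq.summable.mul_left (∑' t, α t)
        exact mul_le_mul_of_nonneg_left (Summable.tsum_le_tsum key (hs.of_nonneg_of_le
          (fun n => mul_nonneg (Finset.sum_nonneg fun _ _ => h0 _) (by positivity)) key) hs) hK
    _ = ((∑' t, α t) * ‖b‖) ^ 2 := by
        rw [tsum_mul_left, b.hasSum_sq.tsum_eq]; ring

/-- The matrix of `L` is dominated by the function `a` of the difference of the indices. -/
def HasDecay (a : ℤ → ℝ) (L : EllTwo →L[ℂ] EllTwo) : Prop :=
  ∀ m n : ℕ, ‖L (lp.single 2 n 1) m‖ ≤ a (m - n)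

theorem hasSum_apply (L : EllTwo →L[ℂ] EllTwo) (c : EllTwo) (m : ℕ) :
    HasSum (fun n => c n * L (lp.single 2 n 1) m) (L c m) := by
  have h := (lp.hasSum_single (by norm_num) c).mapL ((lp.evalCLM ℂ (fun _ : ℕ => ℂ) 2 m).comp L)
  have e (n : ℕ) : lp.single 2 n (c n) = c n • (lp.single 2 n 1 : EllTwo) := by
    rw [← lp.single_smul, smul_eq_mul, mul_one]
  simp_rw [e, map_smul] at h
  exact h

variable {a : ℤ → ℝ} {L : EllTwo →L[ℂ] EllTwo}

/-- Conjugating by the weight multiplies the entry at `(m, n)` by `w m / w n ≤ v (m - n)`, so the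
conjugated matrix is dominated by the summable function `a v` and Young's inequality applies. -/
theorem HasDecay.exists_weighted (hL : HasDecay a L) {v : ℤ → ℝ} (ha : ∀ t, 0 ≤ a t)
    (hv : ∀ t, 0 ≤ v t) (hav : Summable fun t => a t * v t) {w : ℕ → ℝ} (hw0 : ∀ n, 0 < w n)
    (hw : ∀ m n : ℕ, w m ≤ v (m - n) * w n) {c y : EllTwo} (hy : ∀ n, y n = w n * c n) :
    ∃ z : EllTwo, (∀ n, z n = w n * L c n) ∧ ‖z‖ ≤ (∑' t, a t * v t) * ‖y‖ := by
  have h0 : ∀ t, 0 ≤ a t * v t := fun t => mul_nonneg (ha t) (hv t)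
  refine exists_of_norm_le_conv h0 hav y fun m => ?_
  have h := (hasSum_apply L c m).mul_left (w m : ℂ)
  rw [← h.tsum_eq]
  refine tsum_of_norm_bounded (summable_mul_norm h0 hav y m).hasSum fun n => ?_
  rw [hy, norm_mul, norm_mul, norm_mul, Complex.norm_of_nonneg (hw0 m).le,
    Complex.norm_of_nonneg (hw0 n).le]
  calc w m * (‖c n‖ * ‖L (lp.single 2 n 1) m‖) ≤ (v (m - n) * w n) * (‖c n‖ * a (m - n)) := by
        gcongr
        · exact mul_nonneg (hv _) (hw0 n).le
        · exact hw m n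
        · exact hL m n
    _ = _ := by ring

/-- The vector `z - L y` is the commutator of the weight with `L`, applied to `c`. Its matrix has
the entries `(w m - w n) L_mn`, and the slow variation of `w` gives `|w m - w n| ≤ (v (m - n) - 1) w
n`, so Young's inequality yields a small bound when `v` is close to `1`. -/
theorem HasDecay.norm_commutator_le (hL : HasDecay a L) {v : ℤ → ℝ} (ha : ∀ t, 0 ≤ a t)
    (hv : ∀ t, 1 ≤ v t) (hvs : ∀ t, v (-t) = v t) (hav : Summable fun t => a t * (v t - 1))
    {w : ℕ → ℝ} (hw0 : ∀ n, 0 < w n)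
    (hw : ∀ m n : ℕ, w m ≤ v (m - n) * w n) {c y z : EllTwo} (hy : ∀ n, y n = w n * c n)
    (hz : ∀ n, z n = w n * L c n) :
    ‖z - L y‖ ≤ (∑' t, a t * (v t - 1)) * ‖y‖ := by
  have h0 : ∀ t, 0 ≤ a t * (v t - 1) := fun t => mul_nonneg (ha t) (by linarith [hv t])
  obtain ⟨u, hu, hn⟩ := exists_of_norm_le_conv h0 hav y (x := fun m => (z - L y) m) fun m => by
    have h := ((hasSum_apply L c m).mul_left (w m : ℂ)).sub (hasSum_apply L y m)
    rw [← hz] at h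
    have hzy : (z - L y) m = z m - L y m := rfl
    rw [hzy, ← h.tsum_eq]
    refine tsum_of_norm_bounded (summable_mul_norm h0 hav y m).hasSum fun n => ?_
    have hd : |w m - w n| ≤ (v (m - n) - 1) * w n := by
      have h1 := hw m n
      have h2 := hw n m
      rw [← hvs, neg_sub] at h2
      have h3 := hv (m - n)
      have h4 := hw0 n
      have h5 := hw0 m
      rw [abs_le]
      constructor
      -- The symmetry of `v` gives `w n - w m ≤ (v - 1) w m`; the larger weight may replace `w m` on
      -- the right, and otherwise the left side is negative.
      · by_cases hmn : w m ≤ w n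
        · nlinarith
        · nlinarith
      · linarith
    have e1 : (w m : ℂ) * (c n * L (lp.single 2 n 1) m) - y n * L (lp.single 2 n 1) m =
        ((w m - w n : ℝ) : ℂ) * (c n * L (lp.single 2 n 1) m) := by
      rw [hy]; push_cast; ring
    rw [e1, hy, norm_mul, norm_mul, norm_mul, Complex.norm_of_nonneg (hw0 n).le,
      Complex.norm_real, Real.norm_eq_abs]
    calc |w m - w n| * (‖c n‖ * ‖L (lp.single 2 n 1) m‖)
        ≤ ((v (m - n) - 1) * w n) * (‖c n‖ * a (m - n)) := by
          gcongr
          · exact mul_nonneg (by linarith [hv (m - n)]) (hw0 n).le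
          · exact hL m n
      _ = _ := by ring
  have : u = z - L y := lp.ext (funext hu)
  rwa [← this]

/-- `w` is equivalent to weights that vary arbitrarily slowly, as measured by the decay `a`. -/
def IsSlowFor (a : ℤ → ℝ) (w : ℕ → ℝ) : Prop :=
  ∀ η > 0, ∃ (w' : ℕ → ℝ) (v : ℤ → ℝ) (C : ℝ), 0 < C ∧ (∀ n, 0 < w' n) ∧ (∀ n, w n ≤ w' n) ∧
    (∀ n, w' n ≤ C * w n) ∧ (∀ m n : ℕ, w' m ≤ v (m - n) * w' n) ∧ (∀ t, 1 ≤ v t) ∧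
    (∀ t, v (-t) = v t) ∧ (Summable fun t => a t * (v t - 1)) ∧ ∑' t, a t * (v t - 1) ≤ η

theorem norm_weight_mul {w : ℕ → ℝ} (hw : ∀ n, 0 < w n) (n : ℕ) (x : ℂ) :
    ‖(w n : ℂ) * x‖ = w n * ‖x‖ := by
  rw [norm_mul, Complex.norm_of_nonneg (hw n).le]

/-- An operator with a decaying matrix is bounded on weighted `ℓ²`. -/
theorem HasDecay.exists_bound (hL : HasDecay a L) (ha : ∀ t, 0 ≤ a t) (has : Summable a)
    {w : ℕ → ℝ} (hw0 : ∀ n, 0 < w n) (hw : IsSlowFor a w) :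
    ∃ K > 0, ∀ c y : EllTwo, (∀ n, y n = w n * c n) →
      ∃ z : EllTwo, (∀ n, z n = w n * L c n) ∧ ‖z‖ ≤ K * ‖y‖ := by
  -- Any tolerance would do here: only the summability of `a v = a (v - 1) + a` matters, not its
  -- size.
  obtain ⟨w', v, C, hC, hw'0, hww', hw'w, hv, hv1, -, hav, -⟩ := hw 1 one_pos
  have hav' : Summable fun t => a t * v t := (hav.add has).congr fun t => by ring
  have hK : 0 ≤ ∑' t, a t * v t :=
    tsum_nonneg fun t => mul_nonneg (ha t) (by linarith [hv1 t])
  refine ⟨(∑' t, a t * v t) * C + 1, by positivity, fun c y hy => ?_⟩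
  obtain ⟨y', hy', hyn⟩ := exists_of_norm_le (x := fun n => w' n * c n) hC.le y fun n => by
    rw [hy, norm_weight_mul hw0, norm_weight_mul hw'0, ← mul_assoc]
    exact mul_le_mul_of_nonneg_right (hw'w n) (norm_nonneg _)
  obtain ⟨z', hz', hzn⟩ := hL.exists_weighted ha (fun t => by linarith [hv1 t]) hav' hw'0 hv hy'
  obtain ⟨z, hz, hn⟩ := exists_of_norm_le (x := fun n => w n * L c n) zero_le_one z' fun n => by
    rw [hz', norm_weight_mul hw0, norm_weight_mul hw'0, one_mul]
    exact mul_le_mul_of_nonneg_right (hww' n) (norm_nonneg _)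
  refine ⟨z, hz, ?_⟩
  have := mul_le_mul_of_nonneg_left hyn hK
  nlinarith [norm_nonneg y]

/-- If a product of two operators with decaying matrices is bounded below on `ℓ²`, then it is
bounded below on weighted `ℓ²`. -/
theorem HasDecay.exists_bound_of_comp {P R : EllTwo →L[ℂ] EllTwo} (hP : HasDecay a P)
    (hR : HasDecay a R) (ha : ∀ t, 0 ≤ a t) (has : Summable a) {κ : ℝ} (hκ : 0 < κ)
    (hPR : ∀ c, ‖c‖ ≤ κ * ‖P (R c)‖) {w : ℕ → ℝ} (hw0 : ∀ n, 0 < w n) (hw : IsSlowFor a w) :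
    ∃ K > 0, ∀ c y : EllTwo, (∀ n, y n = w n * P (R c) n) →
      ∃ z : EllTwo, (∀ n, z n = w n * c n) ∧ ‖z‖ ≤ K * ‖y‖ := by
  have hA : 0 ≤ ∑' t, a t := tsum_nonneg ha
  -- `Q η` is the total factor in front of `‖z‖` produced by the two commutators. The tolerance `1`
  -- ensures `∑ a v ≤ ∑ a + 1`, and `1 / (2 Q)` makes that factor at most `1 / 2`.
  set Q : ℝ := κ * (∑' t, a t + 1 + ‖P‖) with hQ
  have hQ0 : 0 < Q := by positivity
  obtain ⟨w', v, C, hC, hw'0, hww', hw'w, hv, hv1, hvs, hav, hη⟩ :=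
    hw (min 1 (1 / (2 * Q))) (by positivity)
  set η := ∑' t, a t * (v t - 1) with hηdef
  have hη0 : 0 ≤ η := tsum_nonneg fun t => mul_nonneg (ha t) (by linarith [hv1 t])
  have hη1 : η ≤ 1 := hη.trans (min_le_left _ _)
  have hηQ : Q * η ≤ 1 / 2 := by
    have := mul_le_mul_of_nonneg_left (hη.trans (min_le_right _ _)) hQ0.le
    rwa [show Q * (1 / (2 * Q)) = 1 / 2 by field_simp] at this
  have hav' : Summable fun t => a t * v t := (hav.add has).congr fun t => by ring
  have hKv : ∑' t, a t * v t ≤ ∑' t, a t + 1 := by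
    have : ∑' t, a t * v t = ∑' t, a t + η := by
      rw [hηdef, ← has.tsum_add hav]
      exact tsum_congr fun t => by ring
    linarith
  refine ⟨2 * κ * C, by positivity, fun c y hy => ?_⟩
  obtain ⟨y', hy', hyn⟩ := exists_of_norm_le (x := fun n => w' n * P (R c) n) hC.le y fun n => by
    rw [hy, norm_weight_mul hw0, norm_weight_mul hw'0, ← mul_assoc]
    exact mul_le_mul_of_nonneg_right (hw'w n) (norm_nonneg _)
  -- Absorbing half of `‖z‖` requires `z` to be in `ℓ²` beforehand, so the weight is truncated at
  -- `N`. Since `v ≥ 1`, the truncated weight varies as slowly as `w'`, and the bound obtained does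
  -- not depend on `N`.
  have trunc (N : ℝ) (hN : 0 < N) : ∃ z : EllTwo, (∀ n, z n = (min (w' n) N : ℝ) * c n) ∧
      ‖z‖ ≤ 2 * κ * C * ‖y‖ := by
    set D : ℕ → ℝ := fun n => min (w' n) N with hD
    have hD0 : ∀ n, 0 < D n := fun n => lt_min (hw'0 n) hN
    have hDv : ∀ m n : ℕ, D m ≤ v (m - n) * D n := fun m n => by
      have h1 := hv1 (m - n)
      rw [hD]
      dsimp only
      rw [mul_min_of_nonneg _ _ (by linarith)]
      exact min_le_min (hv m n) (by nlinarith)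
    have hDc (x : EllTwo) : ∃ z : EllTwo, (∀ n, z n = D n * x n) ∧ ‖z‖ ≤ N * ‖x‖ :=
      exists_of_norm_le hN.le x fun n => by
        rw [norm_weight_mul hD0]
        exact mul_le_mul_of_nonneg_right (min_le_right _ _) (norm_nonneg _)
    -- Here `z = D c`, `x = D R c`, `u = D P R c`, so `x - R z` and `u - P x` are the two
    -- commutators and `P R z = u - (u - P x) - P (x - R z)`.
    obtain ⟨z, hz, -⟩ := hDc c
    obtain ⟨u, hu, -⟩ := hDc (P (R c))
    obtain ⟨x, hx, hxn⟩ := hR.exists_weighted ha (fun t => by linarith [hv1 t]) hav' hD0 hDv hz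
    have h1 := hR.norm_commutator_le ha hv1 hvs hav hD0 hDv hz hx
    have h2 := hP.norm_commutator_le ha hv1 hvs hav hD0 hDv hx hu
    have hun : ‖u‖ ≤ 1 * ‖y'‖ := norm_le_of_norm_apply_le zero_le_one fun n => by
      rw [hu, hy', norm_weight_mul hD0, norm_weight_mul hw'0, one_mul]
      exact mul_le_mul_of_nonneg_right (min_le_left _ _) (norm_nonneg _)
    refine ⟨z, hz, ?_⟩
    have h3 : ‖x‖ ≤ (∑' t, a t + 1) * ‖z‖ :=
      hxn.trans (mul_le_mul_of_nonneg_right hKv (norm_nonneg _))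
    have h4 : ‖P (x - R z)‖ ≤ ‖P‖ * (η * ‖z‖) :=
      (P.le_opNorm _).trans (mul_le_mul_of_nonneg_left h1 (norm_nonneg _))
    have h5 : P (R z) = u - (u - P x) - P (x - R z) := by rw [map_sub]; abel
    have h6 : ‖P (R z)‖ ≤ ‖u‖ + ‖u - P x‖ + ‖P (x - R z)‖ := by
      rw [h5]
      exact (norm_sub_le _ _).trans (add_le_add_left (norm_sub_le _ _) _)
    have h7 : η * ‖x‖ ≤ η * ((∑' t, a t + 1) * ‖z‖) := mul_le_mul_of_nonneg_left h3 hη0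
    have h8 : ‖P (R z)‖ ≤ C * ‖y‖ + (∑' t, a t + 1 + ‖P‖) * η * ‖z‖ := by nlinarith
    have h9 := (hPR z).trans (mul_le_mul_of_nonneg_left h8 hκ.le)
    have h10 : κ * ((∑' t, a t + 1 + ‖P‖) * η * ‖z‖) = Q * η * ‖z‖ := by rw [hQ]; ring
    have h11 : Q * η * ‖z‖ ≤ 1 / 2 * ‖z‖ := mul_le_mul_of_nonneg_right hηQ (norm_nonneg _)
    nlinarith
  -- On a finite set of indices the truncation is invisible once `N` exceeds the values of `w'`
  -- there.
  obtain ⟨z', hz', hn'⟩ := exists_of_sum_sq_le (x := fun n => w' n * c n)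
      (B := 2 * κ * C * ‖y‖) (by positivity) fun s => by
    obtain ⟨N, hN⟩ := (s.image w').bddAbove
    obtain ⟨z, hz, hn⟩ := trunc (max N 1) (by positivity)
    refine le_trans (le_of_eq (Finset.sum_congr rfl fun n hns => ?_)) ((z.sum_sq_le s).trans
      (pow_le_pow_left₀ (norm_nonneg _) hn 2))
    rw [hz, min_eq_left ((hN (by exact_mod_cast Finset.mem_image_of_mem w' hns)).trans
      (le_max_left _ _))]
  obtain ⟨z, hz, hn⟩ := exists_of_norm_le (x := fun n => w n * c n) zero_le_one z' fun n => by
    rw [hz', norm_weight_mul hw0, norm_weight_mul hw'0, one_mul]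
    exact mul_le_mul_of_nonneg_right (hww' n) (norm_nonneg _)
  exact ⟨z, hz, hn.trans (by rwa [one_mul])⟩

end EllTwo

/-! ### Slowly varying equivalents of weights -/

namespace EllTwo

/-- The regularized weight is `w' n = sup_m w m / v_ε (m - n)`. The term `m = n` gives `w ≤ w'`, the
growth bound on `w` gives `w' ≤ C w`, and submultiplicativity of `v_ε` passes to `w' m ≤ v_ε (m - n)
w' n`. As `v_ε - 1 ≤ ε V` with `a V` summable, a small `ε` meets any tolerance. -/
theorem isSlowFor_of_family {a : ℤ → ℝ} {w : ℕ → ℝ} (ha : ∀ t, 0 ≤ a t) (hw0 : ∀ n, 0 < w n)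
    {V : ℤ → ℝ} (hV : Summable fun t => a t * V t) {δ : ℝ} (hδ : 0 < δ) (v : ℝ → ℤ → ℝ)
    (hv1 : ∀ ε t, 0 < ε → 1 ≤ v ε t) (hv0 : ∀ ε, v ε 0 = 1) (hvs : ∀ ε t, v ε (-t) = v ε t)
    (hvm : ∀ ε s t, 0 < ε → v ε (s + t) ≤ v ε s * v ε t)
    (hvV : ∀ ε t, 0 < ε → ε ≤ δ → v ε t - 1 ≤ ε * V t)
    (hvw : ∀ ε, 0 < ε → ε ≤ δ → ∃ C, ∀ m n : ℕ, w m ≤ C * v ε (m - n) * w n) :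
    IsSlowFor a w := by
  intro η hη
  set σ : ℝ := ∑' t, a t * V t with hσ
  obtain ⟨ε, hε, hεδ, hεη⟩ : ∃ ε > 0, ε ≤ δ ∧ ε * σ ≤ η := by
    refine ⟨min δ (η / (|σ| + 1)), by positivity, min_le_left _ _, ?_⟩
    calc min δ (η / (|σ| + 1)) * σ ≤ min δ (η / (|σ| + 1)) * (|σ| + 1) :=
          mul_le_mul_of_nonneg_left (by linarith [le_abs_self σ]) (by positivity)
      _ ≤ η / (|σ| + 1) * (|σ| + 1) :=
          mul_le_mul_of_nonneg_right (min_le_right _ _) (by positivity)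
      _ = η := by field_simp
  obtain ⟨C, hC⟩ := hvw ε hε hεδ
  have hpos t : 0 < v ε t := one_pos.trans_le (hv1 ε t hε)
  have hbd (n : ℕ) (m : ℕ) : w m / v ε (m - n) ≤ C * w n := by
    rw [div_le_iff₀ (hpos _)]
    exact (hC m n).trans (le_of_eq (by ring))
  have hbdd (n : ℕ) : BddAbove (Set.range fun m : ℕ => w m / v ε (m - n)) :=
    ⟨C * w n, by rintro _ ⟨m, rfl⟩; exact hbd n m⟩
  have hle (n : ℕ) : w n ≤ ⨆ m : ℕ, w m / v ε (m - n) := by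
    have := le_ciSup (hbdd n) n
    simpa [hv0] using this
  have hC0 : 0 < C := by
    have h := hC 0 0
    simp only [sub_self, hv0, mul_one] at h
    have := hw0 0
    by_contra hneg
    nlinarith
  have hsum : Summable fun t => a t * (v ε t - 1) :=
    (hV.mul_left ε).of_nonneg_of_le
      (fun t => mul_nonneg (ha t) (by linarith [hv1 ε t hε])) fun t => by
        have := mul_le_mul_of_nonneg_left (hvV ε t hε hεδ) (ha t)
        linarith
  refine ⟨fun n => ⨆ m : ℕ, w m / v ε (m - n), v ε, C, hC0, fun n => (hw0 n).trans_le (hle n), hle,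
    fun n => ciSup_le (hbd n), fun m n => ciSup_le fun j => ?_, fun t => hv1 ε t hε, hvs ε,
    hsum, ?_⟩
  · have h1 := le_ciSup (hbdd n) j
    rw [div_le_iff₀ (hpos _)]
    have h2 : w j ≤ (⨆ m : ℕ, w m / v ε (m - n)) * v ε (j - n) := by
      rwa [← div_le_iff₀ (hpos _)]
    have h3 : v ε (j - n) ≤ v ε (j - m) * v ε (m - n) := by
      have := hvm ε (j - m) (m - n) hε
      rwa [sub_add_sub_cancel] at this
    refine h2.trans ((mul_le_mul_of_nonneg_left h3 ((hw0 n).le.trans (hle n))).trans ?_)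
    exact le_of_eq (by ring)
  · refine le_trans ?_ hεη
    rw [hσ, ← tsum_mul_left]
    refine Summable.tsum_le_tsum (fun t => ?_) hsum (hV.mul_left ε)
    have := mul_le_mul_of_nonneg_left (hvV ε t hε hεδ) (ha t)
    linarith

theorem summable_int_of_abs {f : ℝ → ℝ} (h : Summable fun n : ℕ => f n) :
    Summable fun t : ℤ => f |(t : ℝ)| := by
  rw [summable_int_iff_summable_nat_and_neg]
  constructor <;> simpa using h

theorem summable_one_add_abs_inv_sq : Summable fun t : ℤ => ((1 + |(t : ℝ)|) ^ 2)⁻¹ := by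
  refine summable_int_of_abs (f := fun x => ((1 + x) ^ 2)⁻¹) ?_
  have h := (summable_nat_add_iff 1).2 (Real.summable_nat_pow_inv.2 (one_lt_two))
  refine h.congr fun n => ?_
  push_cast
  rw [add_comm]

/-- With `y = n ^ β`, the decay `exp (-c y) = o(y ^ (-2 / β))` is `o(n ^ (-2))`. -/
theorem summable_exp_neg_rpow {c β : ℝ} (hc : 0 < c) (hβ : 0 < β) :
    Summable fun t : ℤ => Real.exp (-(c * |(t : ℝ)| ^ β)) := by
  refine summable_int_of_abs (f := fun x => Real.exp (-(c * x ^ β))) ?_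
  have h1 := isLittleO_exp_neg_mul_rpow_atTop hc (-(2 / β))
  have h2 : Tendsto (fun n : ℕ => (n : ℝ) ^ β) atTop atTop :=
    (tendsto_rpow_atTop hβ).comp tendsto_natCast_atTop_atTop
  have h3 := (h1.comp_tendsto h2).isBigO
  have h4 : Summable fun n : ℕ => ((n : ℝ) ^ β) ^ (-(2 / β)) := by
    refine (Real.summable_nat_rpow (p := -2) |>.2 (by norm_num)).congr fun n => ?_
    rw [← Real.rpow_mul (by positivity)]
    congr 1
    field_simp
  refine (summable_of_isBigO_nat h4 h3).congr fun n => ?_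
  simp

/-- Convexity: as a function of `ε`, the left side lies below its chord over `[0, 1]`. -/
theorem one_add_mul_pow_le {ε x : ℝ} (hε : 0 < ε) (h : ε ≤ 1) (hx : 0 ≤ x) (k : ℕ) :
    (1 + ε * x) ^ k ≤ 1 + ε * ((1 + x) ^ k - 1) := by
  induction k with
  | zero => simp
  | succ k ih =>
    have h1 : 1 ≤ (1 + x) ^ k := one_le_pow₀ (by linarith)
    have h2 := mul_le_mul_of_nonneg_right ih (by positivity : 0 ≤ 1 + ε * x)
    have h3 : ε * ε * (((1 + x) ^ k - 1) * x) ≤ ε * 1 * (((1 + x) ^ k - 1) * x) := by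
      gcongr
    rw [pow_succ, pow_succ]
    nlinarith

/-- The family is `v_ε t = (1 + ε |t|) ^ k`, comparable to `(1 + |t|) ^ k` up to the factor `ε ^ k`.
Of the decay exponent `k + 2`, the part `k` pays for `V` and the remaining `2` for summability. -/
theorem isSlowFor_of_moderate {k : ℕ} {C : ℝ} (hC : 0 ≤ C) {w : ℕ → ℝ} (hw0 : ∀ n, 0 < w n)
    {B : ℝ} (hB : 0 ≤ B) (hw : ∀ m n : ℕ, w m ≤ B * (1 + |((m - n : ℤ) : ℝ)|) ^ k * w n) :
    IsSlowFor (fun t : ℤ => C * ((1 + |(t : ℝ)|) ^ (k + 2))⁻¹) w := by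
  refine isSlowFor_of_family (fun t => by positivity) hw0 (V := fun t => (1 + |(t : ℝ)|) ^ k) ?_
    one_pos (fun ε t => (1 + ε * |(t : ℝ)|) ^ k) (fun ε t hε => one_le_pow₀ (by
      have : 0 ≤ ε * |(t : ℝ)| := by positivity
      linarith)) (by simp) (by simp) ?_ ?_ ?_
  · refine (summable_one_add_abs_inv_sq.mul_left C).congr fun t => ?_
    field_simp
    ring
  · intro ε s t hε
    rw [← mul_pow]
    refine pow_le_pow_left₀ (by positivity) ?_ k
    have h := abs_add_le (s : ℝ) t
    push_cast
    have h1 : ε * |(s : ℝ) + t| ≤ ε * (|(s : ℝ)| + |(t : ℝ)|) := mul_le_mul_of_nonneg_left h hε.le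
    have h2 : 0 ≤ (ε * |(s : ℝ)|) * (ε * |(t : ℝ)|) := by positivity
    linarith
  · intro ε t hε hε1
    have hx := abs_nonneg (t : ℝ)
    generalize |(t : ℝ)| = x at hx
    linarith [one_add_mul_pow_le hε hε1 hx k]
  · intro ε hε hε1
    refine ⟨B * (ε ^ k)⁻¹, fun m n => (hw m n).trans ?_⟩
    refine mul_le_mul_of_nonneg_right ?_ (hw0 n).le
    rw [mul_assoc]
    refine mul_le_mul_of_nonneg_left ?_ hB
    rw [← inv_pow, ← mul_pow]
    refine pow_le_pow_left₀ (by positivity) ?_ k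
    have hx := abs_nonneg ((m - n : ℤ) : ℝ)
    generalize |((m - n : ℤ) : ℝ)| = x at hx
    rw [inv_mul_eq_div, le_div_iff₀ hε]
    nlinarith

/-- The strictly larger exponent wins for large `x`, however small `ε` is; the constant covers
bounded `x`. -/
theorem exists_mul_rpow_le {β' β : ℝ} (hβ' : 0 < β') (h : β' < β) {γ ε : ℝ} (hγ : 0 ≤ γ)
    (hε : 0 < ε) : ∃ B, ∀ x : ℝ, 0 ≤ x → γ * x ^ β' ≤ B + ε * x ^ β := by
  have hlim := tendsto_rpow_atTop (sub_pos.2 h)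
  obtain ⟨T, hT⟩ := (hlim.eventually_ge_atTop (γ / ε)).exists_forall_of_atTop
  refine ⟨γ * (max T 1) ^ β', fun x hx => ?_⟩
  have hB : 0 ≤ γ * (max T 1) ^ β' := by positivity
  rcases le_total x (max T 1) with hxT | hxT
  · have := mul_le_mul_of_nonneg_left (Real.rpow_le_rpow hx hxT hβ'.le) hγ
    have : 0 ≤ ε * x ^ β := by positivity
    linarith
  · have hx1 : 0 < x := by have := le_max_right T 1; linarith
    have h1 := hT x ((le_max_left _ _).trans hxT)
    rw [div_le_iff₀ hε] at h1
    have h2 : x ^ β = x ^ (β - β') * x ^ β' := by rw [← Real.rpow_add hx1]; simp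
    have := mul_le_mul_of_nonneg_right h1 (Real.rpow_nonneg hx β')
    rw [h2]
    linarith

/-- Convexity of `exp` on the segment from `0` to `δ x`, at the ratio `ε / δ`. -/
theorem exp_mul_sub_one_le {ε δ x : ℝ} (hε : 0 < ε) (h : ε ≤ δ) :
    Real.exp (ε * x) - 1 ≤ ε * (δ⁻¹ * Real.exp (δ * x)) := by
  have hδ : 0 < δ := hε.trans_le h
  have hc := convexOn_exp.2 (Set.mem_univ (δ * x)) (Set.mem_univ 0)
    (show 0 ≤ ε / δ by positivity) (show 0 ≤ 1 - ε / δ by rw [sub_nonneg, div_le_one hδ]; exact h)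
    (by ring)
  simp only [smul_eq_mul, mul_zero, add_zero, Real.exp_zero, mul_one] at hc
  rw [show ε / δ * (δ * x) = ε * x by field_simp] at hc
  have : 0 ≤ ε / δ := by positivity
  rw [← mul_assoc, ← div_eq_mul_inv]
  linarith

/-- The family is `v_ε t = exp (ε |t| ^ β)`, submultiplicative because `x ^ β` is subadditive for `β
≤ 1`. Half of the decay rate `c` pays for `V`, half for summability. The value `β = 1` is allowed so
as to cover exponential localization. -/
theorem isSlowFor_of_subExp {β' β : ℝ} (hβ' : 0 < β') (h : β' < β) (hβ : β ≤ 1)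
    {C c : ℝ} (hC : 0 ≤ C) (hc : 0 < c) {w : ℕ → ℝ} (hw0 : ∀ n, 0 < w n)
    {B γ : ℝ} (hB : 0 ≤ B) (hγ : 0 ≤ γ)
    (hw : ∀ m n : ℕ, w m ≤ B * Real.exp (γ * |((m - n : ℤ) : ℝ)| ^ β') * w n) :
    IsSlowFor (fun t : ℤ => C * Real.exp (-(c * |(t : ℝ)| ^ β))) w := by
  have hβ0 : 0 < β := hβ'.trans h
  refine isSlowFor_of_family (fun t => by positivity) hw0
    (V := fun t => (c / 2)⁻¹ * Real.exp (c / 2 * |(t : ℝ)| ^ β)) ?_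
    (half_pos hc) (fun ε t => Real.exp (ε * |(t : ℝ)| ^ β))
    (fun ε t hε => Real.one_le_exp (by positivity)) (by simp [hβ0.ne']) (by simp) ?_
    (fun ε t hε hεc => exp_mul_sub_one_le hε hεc) ?_
  · refine ((summable_exp_neg_rpow (half_pos hc) hβ0).mul_left (C * (c / 2)⁻¹)).congr fun t => ?_
    have : Real.exp (-(c / 2 * |(t : ℝ)| ^ β)) =
        Real.exp (-(c * |(t : ℝ)| ^ β)) * Real.exp (c / 2 * |(t : ℝ)| ^ β) := by
      rw [← Real.exp_add]; congr 1; ring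
    rw [this]; ring
  · intro ε s t hε
    rw [← Real.exp_add, ← mul_add]
    refine Real.exp_le_exp.2 (mul_le_mul_of_nonneg_left ?_ hε.le)
    push_cast
    exact (Real.rpow_le_rpow (abs_nonneg _) (abs_add_le _ _) hβ0.le).trans
      (Real.rpow_add_le_add_rpow (abs_nonneg _) (abs_nonneg _) hβ0.le hβ)
  · intro ε hε _
    obtain ⟨B', hB'⟩ := exists_mul_rpow_le hβ' h hγ hε
    refine ⟨B * Real.exp B', fun m n => (hw m n).trans ?_⟩
    refine mul_le_mul_of_nonneg_right ?_ (hw0 n).le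
    rw [mul_assoc, ← Real.exp_add]
    exact mul_le_mul_of_nonneg_left (Real.exp_le_exp.2 (hB' _ (abs_nonneg _))) hB

end EllTwo

/-! ### Frames and Riesz bases in a Hilbert space -/

section Frames

variable {H : Type*} [NormedAddCommGroup H] [InnerProductSpace ℂ H] [CompleteSpace H]

theorem EllTwo.hasSum_map {E : Type*} [AddCommMonoid E] [Module ℂ E] [TopologicalSpace E]
    (T : EllTwo →L[ℂ] E) (c : EllTwo) :
    HasSum (fun n => c n • T (lp.single 2 n 1)) (T c) := by
  have h := (lp.hasSum_single (by norm_num) c).mapL T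
  have e (n : ℕ) : lp.single 2 n (c n) = c n • (lp.single 2 n 1 : EllTwo) := by
    rw [← lp.single_smul, smul_eq_mul, mul_one]
  simp_rw [e, map_smul] at h
  exact h

/-- The analysis operator, the synthesis operator and the frame operator of a frame. -/
theorem IsFrame.exists_operators {e : ℕ → H} (he : IsFrame e) :
    ∃ (U : H →L[ℂ] EllTwo) (T : EllTwo →L[ℂ] H) (S : H ≃L[ℂ] H),
      (∀ f n, U f n = inner ℂ (e n) f) ∧ (∀ n, T (lp.single 2 n 1) = e n) ∧
      (∀ f, S f = T (U f)) ∧ (∀ n, canonicalDual e n = S.symm (e n)) ∧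
      ∀ x y, inner ℂ (S.symm x) y = inner ℂ x (S.symm y) := by
  obtain ⟨A, B, hA, hB, h⟩ := he
  have hU (f : H) : ∃ y : EllTwo, ∀ n, y n = inner ℂ (e n) f :=
    ⟨⟨fun n => inner ℂ (e n) f, memℓp_gen (by simpa using (h f).1)⟩, fun n => rfl⟩
  choose u hu using hU
  have hnorm (f : H) : ‖u f‖ ^ 2 = ∑' n, ‖inner ℂ (e n) f‖ ^ 2 := by
    rw [← (u f).hasSum_sq.tsum_eq]; simp_rw [hu]
  let U : H →L[ℂ] EllTwo := LinearMap.mkContinuous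
    { toFun := u
      map_add' := fun x y => lp.ext (by ext n; simp [hu])
      map_smul' := fun c x => lp.ext (by ext n; simp [hu]) } √B fun f => by
        refine le_of_sq_le_sq ?_ (by positivity)
        rw [mul_pow, Real.sq_sqrt hB.le]
        exact (hnorm f).trans_le (h f).2.2
  have hUe (f n) : U f n = inner ℂ (e n) f := hu f n
  let T : EllTwo →L[ℂ] H := ContinuousLinearMap.adjoint U
  have hT (n : ℕ) : T (lp.single 2 n 1) = e n := ext_inner_right ℂ fun f => by
    rw [ContinuousLinearMap.adjoint_inner_left, lp.inner_single_left, hUe]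
    simp
  have hTU (x y : H) : inner ℂ (T (U x)) y = inner ℂ x (T (U y)) := by
    rw [ContinuousLinearMap.adjoint_inner_left, ContinuousLinearMap.adjoint_inner_right]
  -- Coercivity: `⟨T U x, x⟩ = ‖U x‖² ≥ A ‖x‖²`.
  have hunit : IsUnit (T ∘L U) := by
    refine ContinuousLinearMap.isUnit_of_forall_le_norm_inner_map _ (c := ⟨A, hA.le⟩) hA fun x => ?_
    have : inner ℂ ((T ∘L U) x) x = ((‖U x‖ ^ 2 : ℝ) : ℂ) := by
      rw [ContinuousLinearMap.comp_apply, ContinuousLinearMap.adjoint_inner_left,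
        inner_self_eq_norm_sq_to_K]
      norm_cast
    rw [this, Complex.norm_of_nonneg (by positivity)]
    have := (h x).2.1
    rw [← hnorm] at this
    change ‖x‖ ^ 2 * A ≤ ‖u x‖ ^ 2
    linarith
  obtain ⟨S, hS⟩ : ∃ S : H ≃L[ℂ] H, ∀ f, S f = T (U f) :=
    ⟨ContinuousLinearEquiv.unitsEquiv ℂ H hunit.unit, fun f => rfl⟩
  have hF : frameOperator e = S := by
    ext f
    rw [hS, frameOperator, ← (EllTwo.hasSum_map T (U f)).tsum_eq]
    simp_rw [hT, hUe]
  refine ⟨U, T, S, hUe, hT, hS, fun n => ?_, fun x y => ?_⟩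
  · conv_lhs => rw [canonicalDual, hF, ← S.apply_symm_apply (e n)]
    exact Function.leftInverse_invFun S.injective _
  · conv_lhs => rw [← S.apply_symm_apply y]
    conv_rhs => rw [← S.apply_symm_apply x]
    rw [hS, hS, hTU]

/-- The coefficient map of a Riesz basis. -/
theorem IsRieszBasis.exists_equiv {g : ℕ → H} (hg : IsRieszBasis g) :
    ∃ C : H ≃L[ℂ] EllTwo, (∀ f n, C f n = inner ℂ (canonicalDual g n) f) ∧
      ∀ n, C.symm (lp.single 2 n 1) = g n := by
  obtain ⟨b, Q₀, hQ₀, hgQ⟩ := hg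
  obtain ⟨Q, hQ⟩ : ∃ Q : H ≃L[ℂ] H, (Q : H →L[ℂ] H) = Q₀ :=
    ⟨ContinuousLinearEquiv.ofBijective Q₀ (LinearMap.ker_eq_bot.2 hQ₀.1)
      (LinearMap.range_eq_top.2 hQ₀.2), ContinuousLinearEquiv.coe_ofBijective _ _ _⟩
  have hgQ (n : ℕ) : g n = Q (b n) := by rw [hgQ, ← hQ]; rfl
  set Qa : H →L[ℂ] H := ContinuousLinearMap.adjoint (Q : H →L[ℂ] H) with hQa
  set Ra : H →L[ℂ] H := ContinuousLinearMap.adjoint (Q.symm : H →L[ℂ] H) with hRa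
  have hQR (x : H) : Qa (Ra x) = x := ext_inner_right ℂ fun y => by
    rw [hQa, hRa, ContinuousLinearMap.adjoint_inner_left, ContinuousLinearMap.adjoint_inner_left]
    simp
  have hRQ (x : H) : Ra (Qa x) = x := ext_inner_right ℂ fun y => by
    rw [hQa, hRa, ContinuousLinearMap.adjoint_inner_left, ContinuousLinearMap.adjoint_inner_left]
    simp
  -- The frame operator is `Q Q*`, hence `g̃_n = (Q*)⁻¹ b_n` and `⟨f, g̃_n⟩ = ⟨Q⁻¹ f, b_n⟩`.
  have hF (f : H) : frameOperator g f = Q (Qa f) := by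
    have h := (b.hasSum_repr (Qa f)).mapL (Q : H →L[ℂ] H)
    rw [frameOperator, ← ContinuousLinearEquiv.coe_coe Q, ← h.tsum_eq]
    refine tsum_congr fun n => ?_
    rw [map_smul, b.repr_apply_apply, hQa, ContinuousLinearMap.adjoint_inner_right, hgQ]
    rfl
  have hinj : Function.Injective (frameOperator g) := fun x y hxy => by
    rw [hF, hF] at hxy
    rw [← hRQ x, Q.injective hxy, hRQ]
  have hdual (n : ℕ) : canonicalDual g n = Ra (b n) := by
    have : g n = frameOperator g (Ra (b n)) := by rw [hF, hQR, hgQ]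
    rw [canonicalDual, this]
    exact Function.leftInverse_invFun hinj _
  refine ⟨Q.symm.trans b.repr.toContinuousLinearEquiv, fun f n => ?_, fun n => ?_⟩
  · rw [hdual, hRa, ContinuousLinearMap.adjoint_inner_left]
    exact b.repr_apply_apply _ _
  · rw [hgQ]
    exact congrArg Q (b.repr_symm_single n)

end Frames

/-! ### Chains of normed spaces and their projective limits -/

section Chains

variable {V W : Type*} [AddCommGroup V] [Module ℂ V] [AddCommGroup W] [Module ℂ W]

namespace NormedChain

theorem incl_injective (Y : NormedChain V) : Function.Injective Y.incl :=
  Subtype.coe_injective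

theorem mem_space (Y : NormedChain V) (y : Y.Lim) (k : ℕ) : Y.incl y ∈ Y.space k :=
  (Y.toSpace k y).2

theorem mem_inter_iff (Y : NormedChain V) {x : V} : x ∈ Y.inter ↔ ∀ k, x ∈ Y.space k :=
  Submodule.mem_iInf _

theorem exists_incl_eq (Y : NormedChain V) {x : V} (h : x ∈ Y.inter) :
    ∃ y : Y.Lim, Y.incl y = x := ⟨⟨x, h⟩, rfl⟩

theorem limNorm_eq (Y : NormedChain V) (k : ℕ) (y : Y.Lim) :
    Y.limNorm k y = Y.nrm k ⟨Y.incl y, Y.mem_space y k⟩ := rfl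

/-- A linear map that is bounded for the norms of every level defines an `F`-bounded operator. -/
theorem exists_isFBounded {Y : NormedChain V} {Z : NormedChain W} (A : Y.Lim →ₗ[ℂ] W)
    (h : ∀ k, ∃ K > 0, ∀ y, ∃ hz : A y ∈ Z.space k, Z.nrm k ⟨A y, hz⟩ ≤ K * Y.limNorm k y) :
    ∃ T : Y.Lim →ₗ[ℂ] Z.Lim, (∀ y, Z.incl (T y) = A y) ∧ IsFBounded T := by
  have hmem (y) : A y ∈ Z.inter := Z.mem_inter_iff.2 fun k => by
    obtain ⟨K, -, hK⟩ := h k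
    exact (hK y).1
  refine ⟨LinearMap.codRestrict Z.inter A hmem, fun y => rfl, fun k => ?_⟩
  obtain ⟨K, hK0, hK⟩ := h k
  exact ⟨K, hK0, fun y => (hK y).2⟩

theorem IsFrechetChain.space_le_zero {Y : NormedChain V} (hY : Y.IsFrechetChain) (k : ℕ) :
    Y.space k ≤ Y.space 0 := by
  induction k with
  | zero => exact le_rfl
  | succ k ih => exact (hY.space_le k).trans ih

/-- `L` restricts to an isometric bijection at every level, so each condition is transported.
Surjectivity onto `Y_0` suffices because the spaces decrease. -/
theorem IsFrechetChain.pullback {Y : NormedChain W} (hY : Y.IsFrechetChain) {L : V →ₗ[ℂ] W}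
    (hinj : Function.Injective L) (hsurj : ∀ y, y ∈ Y.space 0 → ∃ x, L x = y) :
    (Y.pullback L).IsFrechetChain := by
  let l (k : ℕ) : (Y.pullback L).space k →ₗ[ℂ] Y.space k := L.restrict fun _ hx => hx
  have hl (k : ℕ) : Function.Surjective (l k) := fun y => by
    obtain ⟨x, hx⟩ := hsurj y (hY.space_le_zero k y.2)
    exact ⟨⟨x, show L x ∈ Y.space k by rw [hx]; exact y.2⟩, Subtype.ext hx⟩
  have hn (k : ℕ) (x : (Y.pullback L).space k) : (Y.pullback L).nrm k x = Y.nrm k (l k x) := rfl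
  have hmem {x : V} : x ∈ (Y.pullback L).inter ↔ L x ∈ Y.inter := by
    simp only [mem_inter_iff]; rfl
  have hlim (z : Y.Lim) : ∃ x : (Y.pullback L).Lim, ∀ k,
      l k ((Y.pullback L).toSpace k x) = Y.toSpace k z := by
    obtain ⟨x, hx⟩ := hsurj (Y.incl z) (Y.mem_space z 0)
    exact ⟨⟨x, hmem.2 (by rw [hx]; exact z.2)⟩, fun k => Subtype.ext hx⟩
  refine ⟨fun k y h => ?_, fun k u hu => ?_, fun k => ?_, ?_, fun k x hx => hY.space_le k hx,
    fun k x => hY.nrm_le k (l (k + 1) x), fun k y ε hε => ?_⟩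
  · have := hY.definite k (l k y) h
    exact Subtype.ext (hinj ((congrArg Subtype.val this).trans (map_zero L).symm))
  · obtain ⟨y, hy⟩ := hY.complete k (fun n => l k (u n)) fun ε hε => by
      obtain ⟨N, hN⟩ := hu ε hε
      refine ⟨N, fun m hm n hn' => ?_⟩
      have := hN m hm n hn'
      rwa [hn, map_sub (l k)] at this
    obtain ⟨x, rfl⟩ := hl k y
    refine ⟨x, hy.congr fun n => ?_⟩
    rw [hn, map_sub (l k)]
  · obtain ⟨D, hD, hd⟩ := hY.separable k
    obtain ⟨r, hr⟩ := (hl k).hasRightInverse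
    refine ⟨r '' D, hD.image r, fun y ε hε => ?_⟩
    obtain ⟨d, hdD, hdy⟩ := hd (l k y) ε hε
    refine ⟨r d, Set.mem_image_of_mem r hdD, ?_⟩
    rwa [hn, map_sub, hr]
  · obtain ⟨y, hy, hy0⟩ := Submodule.exists_mem_ne_zero_of_ne_bot hY.nontrivial
    obtain ⟨x, hx⟩ := hsurj y (Y.mem_inter_iff.1 hy 0)
    refine (Submodule.ne_bot_iff _).2 ⟨x, hmem.2 (hx ▸ hy), ?_⟩
    rintro rfl
    exact hy0 (by rw [← hx, map_zero])
  · obtain ⟨z, hz⟩ := hY.dense k (l k y) ε hε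
    obtain ⟨x, hx⟩ := hlim z
    refine ⟨x, ?_⟩
    rwa [hn, map_sub, hx]

end NormedChain

theorem IsFBounded.continuous {Y : NormedChain V} {Z : NormedChain W} {T : Y.Lim →ₗ[ℂ] Z.Lim}
    (hT : IsFBounded T) : Continuous T := by
  refine WithSeminorms.continuous_of_isBounded Y.withSeminorms Z.withSeminorms T ?_
  refine Seminorm.IsBounded.of_real fun k => ?_
  obtain ⟨C, hC, h⟩ := hT k
  refine ⟨{k}, C, fun y => ?_⟩
  rw [Finset.sup_singleton]
  exact h y

theorem IsFBounded.comp {U : Type*} [AddCommGroup U] [Module ℂ U] {X : NormedChain U}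
    {Y : NormedChain V} {Z : NormedChain W}
    {S : Y.Lim →ₗ[ℂ] Z.Lim} {T : X.Lim →ₗ[ℂ] Y.Lim} (hS : IsFBounded S) (hT : IsFBounded T) :
    IsFBounded (S ∘ₗ T) := fun k => by
  obtain ⟨C, hC, h⟩ := hS k
  obtain ⟨D, hD, h'⟩ := hT k
  refine ⟨C * D, by positivity, fun x => (h _).trans ?_⟩
  rw [mul_assoc]
  exact mul_le_mul_of_nonneg_left (h' x) hC.le

end Chains

/-! ### Weighted `ℓ²` spaces -/

instance EllTwo.separableSpace : TopologicalSpace.SeparableSpace EllTwo := by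
  have hs : TopologicalSpace.IsSeparable
      (Submodule.span ℂ (Set.range fun n => (lp.single 2 n 1 : EllTwo)) : Set EllTwo) :=
    (Set.countable_range _).isSeparable.span
  rw [← TopologicalSpace.isSeparable_univ_iff]
  refine hs.closure.mono fun y _ => ?_
  refine mem_closure_of_tendsto (EllTwo.hasSum_map (ContinuousLinearMap.id ℂ EllTwo) y)
    (Eventually.of_forall fun s => ?_)
  exact Submodule.sum_mem _ fun n _ =>
    Submodule.smul_mem _ _ (Submodule.subset_span (Set.mem_range_self n))

theorem weightedL2ToLp_bijective {w : ℕ → ℝ} (hw : ∀ n, 0 < w n) :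
    Function.Bijective (weightedL2ToLp w) := by
  have hw' (n) : (w n : ℂ) ≠ 0 := by exact_mod_cast (hw n).ne'
  constructor
  · intro a b hab
    ext n
    have : (w n : ℂ) * (a : ℕ → ℂ) n = w n * (b : ℕ → ℂ) n :=
      congrFun (congrArg Subtype.val hab) n
    exact mul_left_cancel₀ (hw' n) this
  · intro y
    have h : (fun n => (w n : ℂ) * (y n / w n)) = y := by
      ext n; exact mul_div_cancel₀ _ (hw' n)
    refine ⟨⟨fun n : ℕ => y n / w n, ?_⟩, lp.ext h⟩
    change Memℓp (fun n => (w n : ℂ) * (y n / w n)) 2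
    rw [h]
    exact y.2

/-! ### The sequence spaces `Θ_k`, their projective limit and its strong dual -/

namespace thetaChain

variable {μ : ℕ → ℝ → ℝ}

theorem exists_nrm_eq {c : ℕ → ℂ} {k : ℕ} {y : EllTwo} (h : ∀ n, y n = μ k (n + 1) * c n) :
    ∃ hc : c ∈ (thetaChain μ).space k, (thetaChain μ).nrm k ⟨c, hc⟩ = ‖y‖ := by
  have e : (fun n : ℕ => (μ k (n + 1) : ℂ) * c n) = y := funext fun n => (h n).symm
  have hc : Memℓp (fun n : ℕ => (μ k (n + 1) : ℂ) * c n) 2 := by rw [e]; exact y.2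
  exact ⟨hc, congrArg norm (lp.ext e : (⟨_, hc⟩ : EllTwo) = y)⟩

theorem exists_ellTwo {c : ℕ → ℂ} {k : ℕ} (hc : c ∈ (thetaChain μ).space k) :
    ∃ y : EllTwo, ∀ n, y n = μ k (n + 1) * c n := ⟨⟨_, hc⟩, fun _ => rfl⟩

theorem mem_space_iff {c : ℕ → ℂ} {k : ℕ} :
    c ∈ (thetaChain μ).space k ↔ ∃ y : EllTwo, ∀ n, y n = μ k (n + 1) * c n :=
  ⟨exists_ellTwo, fun ⟨_, h⟩ => (exists_nrm_eq h).1⟩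

/-- The isometry `c ↦ (μ_k(n) c_n)_n` of `(Θ_F, ‖·‖_k)` into `ℓ²`. -/
noncomputable def toEllTwo (μ : ℕ → ℝ → ℝ) (k : ℕ) : (thetaChain μ).Lim →ₗ[ℂ] EllTwo :=
  (weightedL2ToLp fun n => μ k (n + 1)) ∘ₗ (thetaChain μ).toSpace k

theorem toEllTwo_apply (k : ℕ) (c : (thetaChain μ).Lim) (n : ℕ) :
    toEllTwo μ k c n = μ k (n + 1) * (thetaChain μ).incl c n := rfl

theorem limNorm_eq (k : ℕ) (c : (thetaChain μ).Lim) :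
    (thetaChain μ).limNorm k c = ‖toEllTwo μ k c‖ := rfl

theorem single_mem (n : ℕ) : (Pi.single n 1 : ℕ → ℂ) ∈ (thetaChain μ).inter := by
  refine (NormedChain.mem_inter_iff _).2 fun k => mem_space_iff.2
    ⟨lp.single 2 n (μ k (n + 1) : ℂ), fun m => ?_⟩
  rw [lp.single_apply]
  rcases eq_or_ne m n with rfl | h
  · simp
  · simp [h]

/-- The canonical vectors of `Θ_F`. -/
noncomputable def delta (μ : ℕ → ℝ → ℝ) (n : ℕ) : (thetaChain μ).Lim := ⟨Pi.single n 1, single_mem n⟩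

theorem toEllTwo_delta (k n : ℕ) :
    toEllTwo μ k (delta μ n) = (μ k (n + 1) : ℂ) • (lp.single 2 n 1 : EllTwo) := by
  ext m
  rw [toEllTwo_apply, lp.coeFn_smul, Pi.smul_apply, lp.single_apply]
  change (μ k (m + 1) : ℂ) * (Pi.single n 1 : ℕ → ℂ) m = μ k (n + 1) * (Pi.single n 1 : ℕ → ℂ) m
  rcases eq_or_ne m n with rfl | h
  · rfl
  · simp [h]

theorem toEllTwo_continuous (k : ℕ) : Continuous (toEllTwo μ k) := by
  refine WithSeminorms.continuous_normedSpace_rng EllTwo (thetaChain μ).withSeminorms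
    (toEllTwo μ k) ?_
  refine ⟨{k}, 1, fun c => ?_⟩
  rw [Finset.sup_singleton, one_smul]
  exact le_rfl

theorem hasSum_delta (c : (thetaChain μ).Lim) :
    HasSum (fun n => (thetaChain μ).incl c n • delta μ n) c := by
  refine ((thetaChain μ).withSeminorms.tendsto_nhds _ _).2 fun k ε hε => ?_
  have h := EllTwo.hasSum_map (ContinuousLinearMap.id ℂ EllTwo) (toEllTwo μ k c)
  filter_upwards [Metric.tendsto_nhds.1 h ε hε] with s hs
  rw [dist_eq_norm] at hs
  have e : toEllTwo μ k (∑ n ∈ s, (thetaChain μ).incl c n • delta μ n) =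
      ∑ n ∈ s, toEllTwo μ k c n • (lp.single 2 n 1 : EllTwo) := by
    rw [map_sum]
    refine Finset.sum_congr rfl fun n _ => ?_
    rw [map_smul, toEllTwo_delta, smul_smul, toEllTwo_apply, mul_comm]
  rw [limNorm_eq, map_sub, e]
  exact hs

/-- The coordinate functionals on `Θ_F`. -/
theorem exists_coord (h : ∀ x, μ 0 x = 1) (n : ℕ) : ∃ χ : (thetaChain μ).Lim →L[ℂ] ℂ,
    ∀ c, χ c = (thetaChain μ).incl c n := by
  refine ⟨(lp.evalCLM ℂ (fun _ : ℕ => ℂ) 2 n).comp ⟨toEllTwo μ 0, toEllTwo_continuous 0⟩,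
    fun c => ?_⟩
  change toEllTwo μ 0 c n = _
  rw [toEllTwo_apply, h]
  simp

variable (hpos : ∀ k (n : ℕ), 0 < μ k (n + 1))
  (hmono : ∀ k (n : ℕ), μ k (n + 1) ≤ μ (k + 1) (n + 1))

include hpos in
theorem isBK : (thetaChain μ).IsBK := fun k n => by
  refine ⟨(μ k (n + 1))⁻¹, fun c => ?_⟩
  obtain ⟨y, hy⟩ := exists_ellTwo c.2
  obtain ⟨_, hn⟩ := exists_nrm_eq hy
  rw [show (thetaChain μ).nrm k c = ‖y‖ from hn, inv_mul_eq_div, le_div_iff₀ (hpos k n), mul_comm]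
  have := lp.norm_apply_le_norm (by norm_num) y n
  rwa [hy, EllTwo.norm_weight_mul (w := fun n => μ k (n + 1)) (hpos k)] at this

include hpos hmono in
theorem exists_succ {k : ℕ} {c : ℕ → ℂ} {y : EllTwo} (hy : ∀ n, y n = μ (k + 1) (n + 1) * c n) :
    ∃ z : EllTwo, (∀ n, z n = μ k (n + 1) * c n) ∧ ‖z‖ ≤ ‖y‖ := by
  obtain ⟨z, hz, hn⟩ := EllTwo.exists_of_norm_le (x := fun n => μ k (n + 1) * c n) zero_le_one y
    fun n => by
      rw [hy, EllTwo.norm_weight_mul (w := fun n => μ k (n + 1)) (hpos k),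
        EllTwo.norm_weight_mul (w := fun n => μ (k + 1) (n + 1)) (hpos (k + 1)), one_mul]
      exact mul_le_mul_of_nonneg_right (hmono k n) (norm_nonneg _)
  exact ⟨z, hz, by rwa [one_mul] at hn⟩

include hpos hmono in
theorem isFrechetChain : (thetaChain μ).IsFrechetChain := by
  obtain ⟨L, hn, hb, hL⟩ : ∃ L : ∀ k, (thetaChain μ).space k →ₗ[ℂ] EllTwo,
      (∀ k c, (thetaChain μ).nrm k c = ‖L k c‖) ∧ (∀ k, Function.Bijective (L k)) ∧
      ∀ k c n, L k c n = μ k (n + 1) * (c : ℕ → ℂ) n :=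
    ⟨fun k => weightedL2ToLp fun n => μ k (n + 1), fun k c => rfl,
      fun k => weightedL2ToLp_bijective (hpos k), fun k c n => rfl⟩
  have hle (k) : (thetaChain μ).space (k + 1) ≤ (thetaChain μ).space k := fun c hc => by
    obtain ⟨y, hy⟩ := exists_ellTwo hc
    obtain ⟨z, hz, -⟩ := exists_succ hpos hmono hy
    exact mem_space_iff.2 ⟨z, hz⟩
  refine ⟨fun k y h => ?_, fun k u hu => ?_, fun k => ?_, ?_, hle, fun k c => ?_,
    fun k c ε hε => ?_⟩
  · exact (hb k).1 ((norm_eq_zero.1 ((hn k y).symm.trans h)).trans (map_zero _).symm)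
  · have hc : CauchySeq fun n => L k (u n) :=
      Metric.cauchySeq_iff.2 fun ε hε => by
        obtain ⟨N, hN⟩ := hu ε hε
        refine ⟨N, fun m hm n hn' => ?_⟩
        rw [dist_eq_norm, ← map_sub, ← hn]
        exact hN m hm n hn'
    obtain ⟨y, hy⟩ := cauchySeq_tendsto_of_complete hc
    obtain ⟨c, rfl⟩ := (hb k).2 y
    refine ⟨c, (tendsto_iff_norm_sub_tendsto_zero.1 hy).congr fun n => ?_⟩
    rw [hn, map_sub]
  · obtain ⟨D, hD, hd⟩ := TopologicalSpace.exists_countable_dense EllTwo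
    obtain ⟨r, hr⟩ := (hb k).2.hasRightInverse
    refine ⟨r '' D, hD.image r, fun y ε hε => ?_⟩
    obtain ⟨d, hdD, hdy⟩ := hd.exists_dist_lt (L k y) hε
    refine ⟨r d, Set.mem_image_of_mem r hdD, ?_⟩
    rwa [hn, map_sub, hr, ← dist_eq_norm]
  · refine (Submodule.ne_bot_iff _).2 ⟨_, single_mem 0, fun h => ?_⟩
    simpa using congrFun h 0
  · obtain ⟨y, hy⟩ := exists_ellTwo c.2
    obtain ⟨z, hz, hzy⟩ := exists_succ hpos hmono hy
    obtain ⟨_, h1⟩ := exists_nrm_eq hy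
    obtain ⟨_, h2⟩ := exists_nrm_eq hz
    exact h2.trans_le (hzy.trans h1.ge)
  -- Density: finitely supported sequences lie in `Θ_F` and approximate `c` in every `Θ_k`
  -- containing it.
  · have h := EllTwo.hasSum_map (ContinuousLinearMap.id ℂ EllTwo) (L k c)
    obtain ⟨s, hs⟩ := (Metric.tendsto_nhds.1 h ε hε).exists
    refine ⟨∑ n ∈ s, (c : ℕ → ℂ) n • delta μ n, ?_⟩
    rw [dist_comm, dist_eq_norm] at hs
    have e : L k ((thetaChain μ).toSpace k (∑ n ∈ s, (c : ℕ → ℂ) n • delta μ n)) =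
        ∑ n ∈ s, L k c n • (lp.single 2 n 1 : EllTwo) := by
      have e' (z : (thetaChain μ).Lim) : L k ((thetaChain μ).toSpace k z) = toEllTwo μ k z := by
        ext n
        exact hL k _ n
      rw [e', map_sum]
      refine Finset.sum_congr rfl fun n _ => ?_
      rw [map_smul, toEllTwo_delta, smul_smul, mul_comm, hL]
    rw [hn, map_sub, e]
    exact hs

include hpos hmono in
theorem limNorm_mono {k l : ℕ} (h : k ≤ l) (c : (thetaChain μ).Lim) :
    (thetaChain μ).limNorm k c ≤ (thetaChain μ).limNorm l c := by
  induction l, h using Nat.le_induction with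
  | base => exact le_rfl
  | succ l _ ih =>
    refine ih.trans ?_
    exact (isFrechetChain hpos hmono).nrm_le l ((thetaChain μ).toSpace (l + 1) c)

include hpos hmono in
-- Continuity bounds `U` by finitely many norms; as the norms increase with `k`, the one of largest
-- index dominates.
theorem exists_bound (U : (thetaChain μ).Lim →L[ℂ] ℂ) :
    ∃ k, ∃ C : ℝ, 0 ≤ C ∧ ∀ c, ‖U c‖ ≤ C * (thetaChain μ).limNorm k c := by
  obtain ⟨s, C, -, h⟩ := Seminorm.bound_of_continuous (thetaChain μ).withSeminorms
    ((normSeminorm ℂ ℂ).comp (U : (thetaChain μ).Lim →ₗ[ℂ] ℂ)) (continuous_norm.comp U.continuous)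
  refine ⟨s.sup id, C, C.2, fun c => (h c).trans ?_⟩
  refine mul_le_mul_of_nonneg_left ?_ C.2
  refine Seminorm.finset_sup_apply_le (apply_nonneg _ _) fun k hk => ?_
  exact limNorm_mono hpos hmono (Finset.le_sup (f := id) hk) c

include hpos hmono in
/-- The coefficients of a functional on `Θ_F` belong to the weighted `ℓ²` space dual to some
`Θ_k`. -/
theorem exists_dual_coeff (U : (thetaChain μ).Lim →L[ℂ] ℂ) :
    ∃ (k : ℕ) (y : EllTwo), ∀ n, y n = star (U (delta μ n)) / μ k (n + 1) := by
  obtain ⟨k, C, hC, h⟩ := exists_bound hpos hmono U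
  refine ⟨k, ?_⟩
  have hw (n : ℕ) : (μ k (n + 1) : ℂ) ≠ 0 := by exact_mod_cast (hpos k n).ne'
  set x : ℕ → ℂ := fun n => star (U (delta μ n)) / μ k (n + 1) with hx
  obtain ⟨y, hy, -⟩ := EllTwo.exists_of_sum_sq_le (x := x) hC fun s => by
    -- The extremal test vector: its weighted coordinates are `x n` on `s`, so `U c = ∑ |x n|² =
    -- ‖c‖_k²`, and `‖U c‖ ≤ C ‖c‖_k` forces `‖c‖_k ≤ C`.
    set c : (thetaChain μ).Lim := ∑ n ∈ s, (x n / μ k (n + 1)) • delta μ n with hc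
    have h1 : U c = ((∑ n ∈ s, ‖x n‖ ^ 2 : ℝ) : ℂ) := by
      rw [hc, map_sum, Complex.ofReal_sum]
      refine Finset.sum_congr rfl fun n _ => ?_
      have : U (delta μ n) = star (x n) * μ k (n + 1) := by
        rw [hx]
        simp [hw n]
      rw [map_smul, this, smul_eq_mul, Complex.ofReal_pow, ← Complex.mul_conj']
      have := hw n
      simp only [RCLike.star_def]
      field_simp
    have h2 : toEllTwo μ k c = ∑ n ∈ s, lp.single 2 n (x n) := by
      rw [hc, map_sum]
      refine Finset.sum_congr rfl fun n _ => ?_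
      rw [map_smul, toEllTwo_delta, smul_smul, div_mul_cancel₀ _ (hw n), ← lp.single_smul,
        smul_eq_mul, mul_one]
    have h3 : ‖toEllTwo μ k c‖ ^ 2 = ∑ n ∈ s, ‖x n‖ ^ 2 := by
      have := lp.norm_sum_single (E := fun _ : ℕ => ℂ) (p := 2) (by norm_num) x s
      rw [h2]
      simpa using this
    have h4 := h c
    rw [h1, limNorm_eq, Complex.norm_of_nonneg (by positivity), ← h3] at h4
    rw [← h3]
    refine pow_le_pow_left₀ (norm_nonneg _) ?_ 2
    rcases (norm_nonneg (toEllTwo μ k c)).eq_or_lt with h0 | h0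
    · rwa [← h0]
    · nlinarith
  exact ⟨y, hy⟩

include hpos hmono in
/-- Every functional on `Θ_F` is the sum of its coordinates, in the strong dual. -/
theorem hasSum_dual (U : (thetaChain μ).Lim →L[ℂ] ℂ) {χ : ℕ → (thetaChain μ).Lim →L[ℂ] ℂ}
    (hχ : ∀ n c, χ n c = (thetaChain μ).incl c n) :
    HasSum (fun n => U (delta μ n) • χ n) U := by
  obtain ⟨k, y, hy⟩ := exists_dual_coeff hpos hmono U
  have hw (n : ℕ) : (μ k (n + 1) : ℂ) ≠ 0 := by exact_mod_cast (hpos k n).ne'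
  let A : (thetaChain μ).Lim →L[ℂ] EllTwo := ⟨toEllTwo μ k, toEllTwo_continuous k⟩
  -- The expansion of `y` converges in the norm of `ℓ²`; the Riesz map and precomposition with `Θ_F
  -- → ℓ²` carry it continuously into the strong dual.
  have h := ((lp.hasSum_single (by norm_num) y).mapL (innerSL ℂ)).mapL
    (ContinuousLinearMap.precomp ℂ A)
  have e (n : ℕ) : ContinuousLinearMap.precomp ℂ A (innerSL ℂ (lp.single 2 n (y n) : EllTwo)) =
      U (delta μ n) • χ n := by
    ext c
    change inner ℂ (lp.single 2 n (y n) : EllTwo) (toEllTwo μ k c) = U (delta μ n) * χ n c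
    rw [lp.inner_single_left, hχ, toEllTwo_apply, hy]
    simp only [RCLike.inner_apply, map_div₀, RCLike.star_def, Complex.conj_conj, Complex.conj_ofReal]
    have := hw n
    field_simp
  simp_rw [e] at h
  convert h using 1
  ext c
  have h1 := (hasSum_delta c).mapL U
  have h2 := lp.hasSum_inner (𝕜 := ℂ) (G := fun _ : ℕ => ℂ) y (toEllTwo μ k c)
  have e3 (n : ℕ) : U ((thetaChain μ).incl c n • delta μ n) =
      inner ℂ (y n) (toEllTwo μ k c n) := by
    rw [map_smul, toEllTwo_apply, hy]
    simp only [RCLike.inner_apply, map_div₀, RCLike.star_def, Complex.conj_conj,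
      Complex.conj_ofReal, smul_eq_mul]
    have := hw n
    field_simp
  simp_rw [e3] at h1
  exact h1.unique h2

end thetaChain

/-! ### From localization and weight growth to a summable envelope -/

section Localization

variable {H : Type*} [NormedAddCommGroup H] [InnerProductSpace ℂ H]

/-- The entries of the matrices that describe the localization of `e` with respect to `g` are
dominated by the function `a` of the difference of the indices. -/
def IsLocalizedBy (a : ℤ → ℝ) (e g : ℕ → H) : Prop :=
  ∀ m n : ℕ, max ‖inner ℂ (g n) (e m)‖ ‖inner ℂ (canonicalDual g n) (e m)‖ ≤ a (m - n)

theorem IsSubExpWeight.exists_decay {e g : ℕ → H} {μ : ℝ → ℝ} {β' β c C : ℝ}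
    (hμ : IsSubExpWeight β' μ) (hβ' : β' < β) (hβ : β ≤ 1) (hc : 0 < c) (hC : 0 < C)
    (h : ∀ m n : ℕ, max ‖inner ℂ (g n) (e m)‖ ‖inner ℂ (canonicalDual g n) (e m)‖ ≤
      C * Real.exp (-(c * |(m : ℝ) - n| ^ β))) :
    ∃ a : ℤ → ℝ, (∀ t, 0 ≤ a t) ∧ (∀ t, a (-t) = a t) ∧ Summable a ∧
      EllTwo.IsSlowFor a (fun n => μ (n + 1)) ∧ IsLocalizedBy a e g := by
  obtain ⟨h0, -, -, hpos, B, γ, hB, hγ, hw⟩ := hμ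
  refine ⟨fun t => C * Real.exp (-(c * |(t : ℝ)| ^ β)), fun t => by positivity, by simp,
    (EllTwo.summable_exp_neg_rpow hc (h0.trans hβ')).mul_left C,
    EllTwo.isSlowFor_of_subExp h0 hβ' hβ hC.le hc (fun n => hpos _) hB.le hγ.le fun m n => ?_,
    fun m n => ?_⟩
  · have := hw (m - n) (n + 1)
    -- The index `n` stands for the entry `n + 1`; the shift cancels in differences.
    rw [show (m : ℝ) - n + (n + 1) = m + 1 by ring] at this
    push_cast
    exact this
  · push_cast
    exact h m n

theorem IsModerateWeight.exists_decay {e g : ℕ → H} {μ : ℝ → ℝ} {k : ℕ}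
    (hμ : IsModerateWeight k μ) (h : IsPolyLocalized e g (k + 2 : ℕ)) :
    ∃ a : ℤ → ℝ, (∀ t, 0 ≤ a t) ∧ (∀ t, a (-t) = a t) ∧ Summable a ∧
      EllTwo.IsSlowFor a (fun n => μ (n + 1)) ∧ IsLocalizedBy a e g := by
  obtain ⟨-, -, hpos, B, hB, hw⟩ := hμ
  obtain ⟨C, hC, h⟩ := h
  refine ⟨fun t => C * ((1 + |(t : ℝ)|) ^ (k + 2))⁻¹, fun t => by positivity, by simp, ?_,
    EllTwo.isSlowFor_of_moderate hC.le (fun n => hpos _) hB.le fun m n => ?_, fun m n => ?_⟩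
  · refine (EllTwo.summable_one_add_abs_inv_sq.mul_left C).of_nonneg_of_le
      (fun t => by positivity) fun t => ?_
    have h1 : 1 ≤ 1 + |(t : ℝ)| := by linarith [abs_nonneg (t : ℝ)]
    gcongr
    omega
  · have := hw (m - n) (n + 1)
    rw [show (m : ℝ) - n + (n + 1) = m + 1 by ring, Real.rpow_natCast] at this
    push_cast
    exact this
  · have := h m n
    rw [Real.rpow_neg (by positivity), Real.rpow_natCast] at this
    push_cast
    exact this

end Localization

/-! ### Fréchet frames from left inverses of analysis operators -/

theorem HasSum.seriesTo {M : Type*} [AddCommMonoid M] [TopologicalSpace M] {u : ℕ → M} {x : M}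
    (h : HasSum u x) : SeriesTo u x :=
  h.tendsto_sum_nat

section FrechetFrames

variable {V : Type*} [AddCommGroup V] [Module ℂ V] {X : NormedChain V} {μ : ℕ → ℝ → ℝ}
  {U : X.Lim →ₗ[ℂ] (thetaChain μ).Lim} {T : (thetaChain μ).Lim →ₗ[ℂ] X.Lim}

theorem IsFBounded.hasSum_synthesis (hT : IsFBounded T) (c : (thetaChain μ).Lim) :
    HasSum (fun n => (thetaChain μ).incl c n • T (thetaChain.delta μ n)) (T c) := by
  have h := (thetaChain.hasSum_delta c).mapL ⟨T, hT.continuous⟩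
  simp_rw [map_smul] at h
  exact h

theorem IsFBounded.exists_functionals (hU : IsFBounded U) (h0 : ∀ x, μ 0 x = 1) :
    ∃ φ : ℕ → X.Lim →L[ℂ] ℂ, ∀ n f, φ n f = (thetaChain μ).incl (U f) n := by
  choose χ hχ using fun n => thetaChain.exists_coord (μ := μ) h0 n
  exact ⟨fun n => (χ n).comp ⟨U, hU.continuous⟩, fun n f => hχ n _⟩

variable {φ : ℕ → X.Lim →L[ℂ] ℂ}

/-- The lower frame bound comes from the left inverse: `‖f‖_k = ‖T U f‖_k ≤ C ‖U f‖_k`. -/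
theorem isFrechetFrame_of_leftInverse (hX : X.IsFrechetChain)
    (hpos : ∀ k (n : ℕ), 0 < μ k (n + 1)) (hmono : ∀ k (n : ℕ), μ k (n + 1) ≤ μ (k + 1) (n + 1))
    (hU : IsFBounded U) (hT : IsFBounded T) (hTU : ∀ f, T (U f) = f)
    (hφ : ∀ n f, φ n f = (thetaChain μ).incl (U f) n) :
    IsFrechetFrame X (thetaChain μ) φ := by
  have e (f : X.Lim) : (fun n => φ n f) = (thetaChain μ).incl (U f) := funext fun n => hφ n f
  have hΘ (f : X.Lim) : (fun n => φ n f) ∈ (thetaChain μ).inter := by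
    rw [e]; exact (U f).2
  have e' (f : X.Lim) : (⟨fun n => φ n f, hΘ f⟩ : (thetaChain μ).Lim) = U f :=
    (thetaChain μ).incl_injective (e f)
  refine ⟨hX, thetaChain.isFrechetChain hpos hmono, thetaChain.isBK hpos, hΘ, fun k => ?_,
    T, hT, fun f => ?_⟩
  · obtain ⟨B, hB, hUB⟩ := hU k
    obtain ⟨C, hC, hTC⟩ := hT k
    -- The maximum only serves to make the upper bound at least the lower one.
    refine ⟨C⁻¹, max B C⁻¹, by positivity, le_max_right _ _, fun f => ?_⟩
    rw [e']
    constructor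
    · rw [inv_mul_le_iff₀ hC]
      simpa only [hTU] using hTC (U f)
    · exact (hUB f).trans (mul_le_mul_of_nonneg_right (le_max_left _ _) (apply_nonneg _ _))
  · rw [e', hTU]

theorem memDual_apply (A : (thetaChain μ).Lim →L[ℂ] ℂ) :
    MemDual (thetaChain μ) fun n => A (thetaChain.delta μ n) :=
  ⟨A, fun n => ⟨thetaChain.single_mem n, rfl⟩⟩

/-- The functional is `A ∘ U`, where `A` represents `a`; precomposition with `U` carries the strong
expansion of `A` to that of `A ∘ U`. -/
theorem exists_functional_of_memDual
    (hpos : ∀ k (n : ℕ), 0 < μ k (n + 1)) (hmono : ∀ k (n : ℕ), μ k (n + 1) ≤ μ (k + 1) (n + 1))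
    (h0 : ∀ x, μ 0 x = 1) (hU : IsFBounded U)
    (hφ : ∀ n f, φ n f = (thetaChain μ).incl (U f) n) {a : ℕ → ℂ}
    (ha : MemDual (thetaChain μ) a) :
    ∃ F : X.Lim →L[ℂ] ℂ, SeriesTo (fun n => a n • φ n) F ∧
      ∀ f, SeriesTo (fun n => φ n f * a n) (F f) := by
  obtain ⟨A, hA⟩ := ha
  have ha (n : ℕ) : a n = A (thetaChain.delta μ n) := (hA n).2
  choose χ hχ using fun n => thetaChain.exists_coord (μ := μ) h0 n
  let Uc : X.Lim →L[ℂ] (thetaChain μ).Lim := ⟨U, hU.continuous⟩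
  refine ⟨A.comp Uc, HasSum.seriesTo ?_, fun f => HasSum.seriesTo ?_⟩
  · have h := (thetaChain.hasSum_dual hpos hmono A hχ).mapL (ContinuousLinearMap.precomp ℂ Uc)
    have e (n : ℕ) : ContinuousLinearMap.precomp ℂ Uc (A (thetaChain.delta μ n) • χ n) =
        a n • φ n := by
      ext f
      change A (thetaChain.delta μ n) * χ n (U f) = a n * φ n f
      rw [ha, hχ, hφ]
    simp_rw [e] at h
    exact h
  · have h := (thetaChain.hasSum_delta (U f)).mapL A
    simp_rw [map_smul, smul_eq_mul, ← ha, ← hφ] at h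
    exact h

/-- Since `G = (G ∘ T) ∘ U`, it suffices to expand `G ∘ T` on `Θ_F`. -/
theorem seriesTo_functional_of_leftInverse
    (hpos : ∀ k (n : ℕ), 0 < μ k (n + 1)) (hmono : ∀ k (n : ℕ), μ k (n + 1) ≤ μ (k + 1) (n + 1))
    (h0 : ∀ x, μ 0 x = 1) (hU : IsFBounded U) (hT : IsFBounded T) (hTU : ∀ f, T (U f) = f)
    (hφ : ∀ n f, φ n f = (thetaChain μ).incl (U f) n) (G : X.Lim →L[ℂ] ℂ) :
    SeriesTo (fun n => G (T (thetaChain.delta μ n)) • φ n) G ∧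
      MemDual (thetaChain μ) fun n => G (T (thetaChain.delta μ n)) := by
  let Tc : (thetaChain μ).Lim →L[ℂ] X.Lim := ⟨T, hT.continuous⟩
  have hmem := memDual_apply (G.comp Tc)
  refine ⟨?_, hmem⟩
  obtain ⟨F, hF, hFf⟩ := exists_functional_of_memDual hpos hmono h0 hU hφ hmem
  have : F = G := by
    ext f
    have h := (hT.hasSum_synthesis (U f)).mapL G
    simp_rw [hTU, map_smul, smul_eq_mul, ← hφ] at h
    exact tendsto_nhds_unique (hFf f) h.seriesTo
  rw [this] at hF
  exact hF

end FrechetFrames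

/-! ### The spaces `X_k` -/

section

variable {H : Type*} [NormedAddCommGroup H] [InnerProductSpace ℂ H] {g : ℕ → H} {μ : ℕ → ℝ → ℝ}
  {C : H ≃L[ℂ] EllTwo}

namespace xChain

theorem exists_nrm_eq (hC : ∀ f n, C f n = inner ℂ (canonicalDual g n) f) {f : H} {k : ℕ}
    {y : EllTwo} (h : ∀ n, y n = μ k (n + 1) * C f n) :
    ∃ hf : f ∈ (xChain g μ).space k, (xChain g μ).nrm k ⟨f, hf⟩ = ‖y‖ :=
  thetaChain.exists_nrm_eq (c := coeffMap (canonicalDual g) f) fun n => by rw [h, hC]; rfl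

theorem exists_ellTwo (hC : ∀ f n, C f n = inner ℂ (canonicalDual g n) f) (f : (xChain g μ).Lim)
    (k : ℕ) : ∃ y : EllTwo, (∀ n, y n = μ k (n + 1) * C ((xChain g μ).incl f) n) ∧
      (xChain g μ).limNorm k f = ‖y‖ := by
  obtain ⟨y, hy⟩ := thetaChain.exists_ellTwo ((xChain g μ).mem_space f k)
  have hy' : ∀ n, y n = μ k (n + 1) * C ((xChain g μ).incl f) n := fun n => by
    rw [hy, hC]; rfl
  exact ⟨y, hy', (exists_nrm_eq hC hy').2⟩

theorem isFrechetChain (hC : ∀ f n, C f n = inner ℂ (canonicalDual g n) f)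
    (h0 : ∀ x, μ 0 x = 1) (hpos : ∀ k (n : ℕ), 0 < μ k (n + 1))
    (hmono : ∀ k (n : ℕ), μ k (n + 1) ≤ μ (k + 1) (n + 1)) : (xChain g μ).IsFrechetChain := by
  have e (f : H) : coeffMap (canonicalDual g) f = C f := funext fun n => (hC f n).symm
  refine (thetaChain.isFrechetChain hpos hmono).pullback (fun f f' h => ?_) fun c hc => ?_
  · rw [e, e] at h
    exact C.injective (lp.ext h)
  · obtain ⟨y, hy⟩ := thetaChain.exists_ellTwo hc
    refine ⟨C.symm y, ?_⟩
    rw [e, C.apply_symm_apply]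
    ext n
    rw [hy, h0]
    simp

end xChain

end

/-! ### Analysis, synthesis and inverse frame operators on `X_F` -/

section LocalizedFrames

variable {H : Type*} [NormedAddCommGroup H] [InnerProductSpace ℂ H]
  {g : ℕ → H} {μ : ℕ → ℝ → ℝ} {e : ℕ → H} {C : H ≃L[ℂ] EllTwo} {U₀ : H →L[ℂ] EllTwo}
  {T₀ : EllTwo →L[ℂ] H}

theorem IsLocalizedBy.hasDecay_analysis {a : ℤ → ℝ} (h : IsLocalizedBy a e g)
    (hg : ∀ n, C.symm (lp.single 2 n 1) = g n) (hU : ∀ f n, U₀ f n = inner ℂ (e n) f) :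
    EllTwo.HasDecay a (U₀ ∘L (C.symm : EllTwo →L[ℂ] H)) := fun m n => by
  have := (le_max_left _ _).trans (h m n)
  rw [ContinuousLinearMap.comp_apply, ContinuousLinearEquiv.coe_coe, hg, hU, norm_inner_symm]
  exact this

/-- The entry at `(m, n)` is `⟨e_n, g̃_m⟩`, with the indices in the opposite order to the
localization bound; hence the symmetry of `a`. -/
theorem IsLocalizedBy.hasDecay_synthesis {a : ℤ → ℝ} (h : IsLocalizedBy a e g)
    (has : ∀ t, a (-t) = a t)
    (hC : ∀ f n, C f n = inner ℂ (canonicalDual g n) f) (hT : ∀ n, T₀ (lp.single 2 n 1) = e n) :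
    EllTwo.HasDecay a ((C : H →L[ℂ] EllTwo) ∘L T₀) := fun m n => by
  have := (le_max_right _ _).trans (h n m)
  rw [← has, neg_sub] at this
  rw [ContinuousLinearMap.comp_apply, ContinuousLinearEquiv.coe_coe, hT, hC]
  exact this

theorem exists_isFBounded_analysis (hC : ∀ f n, C f n = inner ℂ (canonicalDual g n) f)
    (hg : ∀ n, C.symm (lp.single 2 n 1) = g n) (hU : ∀ f n, U₀ f n = inner ℂ (e n) f)
    (hpos : ∀ k (n : ℕ), 0 < μ k (n + 1))
    (hdecay : ∀ k, ∃ a : ℤ → ℝ, (∀ t, 0 ≤ a t) ∧ (∀ t, a (-t) = a t) ∧ Summable a ∧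
      EllTwo.IsSlowFor a (fun n => μ k (n + 1)) ∧ IsLocalizedBy a e g) :
    ∃ U : (xChain g μ).Lim →ₗ[ℂ] (thetaChain μ).Lim,
      (∀ f, (thetaChain μ).incl (U f) = coeffMap e ((xChain g μ).incl f)) ∧ IsFBounded U := by
  refine NormedChain.exists_isFBounded (coeffMap e ∘ₗ (xChain g μ).incl) fun k => ?_
  obtain ⟨a, ha, -, has, hslow, hloc⟩ := hdecay k
  obtain ⟨K, hK, h⟩ := (hloc.hasDecay_analysis hg hU).exists_bound ha has (hpos k) hslow
  refine ⟨K, hK, fun f => ?_⟩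
  obtain ⟨y, hy, hyn⟩ := xChain.exists_ellTwo hC f k
  obtain ⟨z, hz, hzn⟩ := h _ y hy
  obtain ⟨hc, hn⟩ := thetaChain.exists_nrm_eq (μ := μ) (k := k) (y := z)
    (c := coeffMap e ((xChain g μ).incl f)) fun n => by
      rw [hz, ContinuousLinearMap.comp_apply, ContinuousLinearEquiv.coe_coe, C.symm_apply_apply, hU]
      rfl
  refine ⟨hc, ?_⟩
  rw [hyn]
  exact hn.trans_le hzn

theorem exists_isFBounded_synthesis (hC : ∀ f n, C f n = inner ℂ (canonicalDual g n) f)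
    (hT : ∀ n, T₀ (lp.single 2 n 1) = e n)
    (h0 : ∀ x, μ 0 x = 1) (hpos : ∀ k (n : ℕ), 0 < μ k (n + 1))
    (hdecay : ∀ k, ∃ a : ℤ → ℝ, (∀ t, 0 ≤ a t) ∧ (∀ t, a (-t) = a t) ∧ Summable a ∧
      EllTwo.IsSlowFor a (fun n => μ k (n + 1)) ∧ IsLocalizedBy a e g) :
    ∃ T : (thetaChain μ).Lim →ₗ[ℂ] (xChain g μ).Lim,
      (∀ c, (xChain g μ).incl (T c) = T₀ (thetaChain.toEllTwo μ 0 c)) ∧ IsFBounded T := by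
  refine NormedChain.exists_isFBounded
    ((T₀ : EllTwo →ₗ[ℂ] H) ∘ₗ thetaChain.toEllTwo μ 0) fun k => ?_
  obtain ⟨a, ha, hsymm, has, hslow, hloc⟩ := hdecay k
  obtain ⟨K, hK, h⟩ := (hloc.hasDecay_synthesis hsymm hC hT).exists_bound ha has (hpos k) hslow
  refine ⟨K, hK, fun c => ?_⟩
  obtain ⟨z, hz, hzn⟩ := h (thetaChain.toEllTwo μ 0 c) (thetaChain.toEllTwo μ k c) fun n => by
    rw [thetaChain.toEllTwo_apply, thetaChain.toEllTwo_apply, h0]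
    simp
  obtain ⟨hf, hn⟩ := xChain.exists_nrm_eq hC (μ := μ) (k := k) (y := z) hz
  exact ⟨hf, hn.trans_le hzn⟩

/-- In coordinates `S₀` is the product `P R` of two decaying matrices. Its weighted lower bound,
applied to `S₀⁻¹ f`, is exactly the boundedness of `S₀⁻¹` in the norm of `X_k`. -/
theorem exists_isFBounded_frameOperator_symm {S₀ : H ≃L[ℂ] H}
    (hC : ∀ f n, C f n = inner ℂ (canonicalDual g n) f)
    (hg : ∀ n, C.symm (lp.single 2 n 1) = g n) (hU : ∀ f n, U₀ f n = inner ℂ (e n) f)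
    (hT : ∀ n, T₀ (lp.single 2 n 1) = e n) (hS : ∀ f, S₀ f = T₀ (U₀ f))
    (hpos : ∀ k (n : ℕ), 0 < μ k (n + 1))
    (hdecay : ∀ k, ∃ a : ℤ → ℝ, (∀ t, 0 ≤ a t) ∧ (∀ t, a (-t) = a t) ∧ Summable a ∧
      EllTwo.IsSlowFor a (fun n => μ k (n + 1)) ∧ IsLocalizedBy a e g) :
    ∃ R : (xChain g μ).Lim →ₗ[ℂ] (xChain g μ).Lim,
      (∀ f, (xChain g μ).incl (R f) = S₀.symm ((xChain g μ).incl f)) ∧ IsFBounded R := by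
  refine NormedChain.exists_isFBounded
    ((S₀.symm : H →ₗ[ℂ] H) ∘ₗ (xChain g μ).incl) fun k => ?_
  obtain ⟨a, ha, hsymm, has, hslow, hloc⟩ := hdecay k
  set P : EllTwo →L[ℂ] EllTwo := (C : H →L[ℂ] EllTwo) ∘L T₀ with hP
  set R : EllTwo →L[ℂ] EllTwo := U₀ ∘L (C.symm : EllTwo →L[ℂ] H) with hR
  have hPR (f : H) : P (R (C f)) = C (S₀ f) := by
    rw [hS, hP, hR]; simp
  -- `N = C S₀⁻¹ C⁻¹` is a left inverse of `P R`, which gives the unweighted lower bound with `κ =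
  -- ‖N‖ + 1`, the summand `1` keeping `κ` positive.
  let N : EllTwo →L[ℂ] EllTwo :=
    (C : H →L[ℂ] EllTwo) ∘L (S₀.symm : H →L[ℂ] H) ∘L (C.symm : EllTwo →L[ℂ] H)
  have hN (c : EllTwo) : N (P (R c)) = c := by
    have := hPR (C.symm c)
    rw [C.apply_symm_apply] at this
    rw [this]
    simp [N]
  obtain ⟨K, hK, h⟩ := (hloc.hasDecay_synthesis hsymm hC hT).exists_bound_of_comp
    (hloc.hasDecay_analysis hg hU) ha has (κ := ‖N‖ + 1) (by positivity) (fun c => by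
      have h1 := N.le_opNorm (P (R c))
      rw [hN] at h1
      have := norm_nonneg (P (R c))
      linarith) (hpos k) hslow
  refine ⟨K, hK, fun f => ?_⟩
  obtain ⟨y, hy, hyn⟩ := xChain.exists_ellTwo hC f k
  obtain ⟨z, hz, hzn⟩ := h (C (S₀.symm ((xChain g μ).incl f))) y fun n => by
    rw [hPR, S₀.apply_symm_apply, hy]
  obtain ⟨hf, hn⟩ := xChain.exists_nrm_eq hC (μ := μ) (k := k) (y := z) hz
  refine ⟨hf, ?_⟩
  rw [hyn]
  exact hn.trans_le hzn

end LocalizedFrames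

/-! ### The main theorem -/

theorem theorem5p1 {H : Type*} [NormedAddCommGroup H] [InnerProductSpace ℂ H] [CompleteSpace H]
    (g : ℕ → H) (hg : IsRieszBasis g)
    (μ : ℕ → ℝ → ℝ) (hμ_zero : ∀ x, μ 0 x = 1) (hμ_mono : ∀ k x, μ k x ≤ μ (k + 1) x)
    (e : ℕ → (xChain g μ).Lim) (he : IsFrame fun n => (xChain g μ).incl (e n))
    (hloc :
      (∃ βs : ℕ → ℝ, (∀ k, IsSubExpWeight (βs k) (μ k)) ∧
        ((∃ β : ℝ, 0 < β ∧ β < 1 ∧ (∀ k, βs k < β) ∧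
            IsSubExpLocalized (fun n => (xChain g μ).incl (e n)) g β) ∨
          IsExpLocalized (fun n => (xChain g μ).incl (e n)) g)) ∨
      ((∀ k : ℕ, IsModerateWeight k (μ k)) ∧
        ∀ s : ℕ, 0 < s → IsPolyLocalized (fun n => (xChain g μ).incl (e n)) g s)) :
    -- the canonical dual `e'` of `e` lies in `X_F`
    ∃ e' : ℕ → (xChain g μ).Lim,
      (∀ n, (xChain g μ).incl (e' n) = canonicalDual (fun n => (xChain g μ).incl (e n)) n) ∧
      -- (i): the operators `U_E`, `T_E`, `S_E`
      (∃ (U : (xChain g μ).Lim →ₗ[ℂ] (thetaChain μ).Lim)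
          (T : (thetaChain μ).Lim →ₗ[ℂ] (xChain g μ).Lim)
          (S : (xChain g μ).Lim →ₗ[ℂ] (xChain g μ).Lim),
        (∀ f n, (thetaChain μ).incl (U f) n =
          inner ℂ ((xChain g μ).incl (e n)) ((xChain g μ).incl f)) ∧ IsFBounded U ∧
        (∀ c, SeriesTo (fun n => (thetaChain μ).incl c n • e n) (T c)) ∧ IsFBounded T ∧
        S = T ∘ₗ U ∧ IsFBounded S ∧ Function.Bijective S ∧
        ∀ f, HasSum
          (fun n => inner ℂ ((xChain g μ).incl (e n)) ((xChain g μ).incl f) • e n) (S f)) ∧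
      -- (ii): the frame expansions in `X_F`
      (∀ f : (xChain g μ).Lim,
        SeriesTo
          (fun n => inner ℂ ((xChain g μ).incl (e' n)) ((xChain g μ).incl f) • e n) f ∧
        SeriesTo
          (fun n => inner ℂ ((xChain g μ).incl (e n)) ((xChain g μ).incl f) • e' n) f ∧
        (fun n => inner ℂ ((xChain g μ).incl (e' n)) ((xChain g μ).incl f)) ∈
          (thetaChain μ).inter ∧
        (fun n => inner ℂ ((xChain g μ).incl (e n)) ((xChain g μ).incl f)) ∈
          (thetaChain μ).inter) ∧
      -- (iii): the transfer of the property `𝒫`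
      (HasPropertyP (xChain g μ) (thetaChain μ) g →
        HasPropertyP (xChain g μ) (thetaChain μ) (fun n => (xChain g μ).incl (e n)) ∧
        HasPropertyP (xChain g μ) (thetaChain μ) (fun n => (xChain g μ).incl (e' n))) ∧
      -- the functionals `f ↦ ⟨f, e_n⟩` and `f ↦ ⟨f, e'_n⟩` in `X_F^*`
      ∃ φ φ' : ℕ → (xChain g μ).Lim →L[ℂ] ℂ,
        (∀ n f, φ n f = inner ℂ ((xChain g μ).incl (e n)) ((xChain g μ).incl f)) ∧
        (∀ n f, φ' n f = inner ℂ ((xChain g μ).incl (e' n)) ((xChain g μ).incl f)) ∧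
        -- (iv): Fréchet frames
        IsFrechetFrame (xChain g μ) (thetaChain μ) φ ∧
        IsFrechetFrame (xChain g μ) (thetaChain μ) φ' ∧
        -- (v): the expansions in `X_F^*`
        (∀ G : (xChain g μ).Lim →L[ℂ] ℂ,
          SeriesTo (fun n => G (e n) • φ' n) G ∧
          SeriesTo (fun n => G (e' n) • φ n) G ∧
          MemDual (thetaChain μ) (fun n => G (e n)) ∧
          MemDual (thetaChain μ) (fun n => G (e' n))) ∧
        -- (vi): series in `X_F^*` with coefficients in `Θ_F^*`
        (∀ a : ℕ → ℂ, MemDual (thetaChain μ) a →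
          (∃ F : (xChain g μ).Lim →L[ℂ] ℂ, SeriesTo (fun n => a n • φ n) F ∧
            ∀ f : (xChain g μ).Lim,
              SeriesTo
                (fun n => inner ℂ ((xChain g μ).incl (e n)) ((xChain g μ).incl f) * a n) (F f)) ∧
          (∃ F : (xChain g μ).Lim →L[ℂ] ℂ, SeriesTo (fun n => a n • φ' n) F ∧
            ∀ f : (xChain g μ).Lim,
              SeriesTo
                (fun n => inner ℂ ((xChain g μ).incl (e' n)) ((xChain g μ).incl f) * a n)
                (F f))) := by
  obtain ⟨C, hC, hCg⟩ := hg.exists_equiv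
  obtain ⟨U₀, T₀, S₀, hU₀, hT₀, hS₀, hdual, hself⟩ := he.exists_operators
  have h1 (k : ℕ) (x : ℝ) : 1 ≤ μ k x := by
    induction k with
    | zero => exact (hμ_zero x).ge
    | succ k ih => exact ih.trans (hμ_mono k x)
  have hpos (k n : ℕ) : 0 < μ k (n + 1) := one_pos.trans_le (h1 k _)
  have hmono (k n : ℕ) : μ k (n + 1) ≤ μ (k + 1) (n + 1) := hμ_mono k _
  have hdecay (k : ℕ) : ∃ a : ℤ → ℝ, (∀ t, 0 ≤ a t) ∧ (∀ t, a (-t) = a t) ∧ Summable a ∧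
      EllTwo.IsSlowFor a (fun n => μ k (n + 1)) ∧
      IsLocalizedBy a (fun n => (xChain g μ).incl (e n)) g := by
    rcases hloc with ⟨βs, hβs, ⟨β, -, hβ1, hβ, c, D, hc, hD, h⟩ | ⟨c, D, hc, hD, h⟩⟩ | ⟨hμ, h⟩
    · exact (hβs k).exists_decay (hβ k) hβ1.le hc hD h
    -- Exponential localization is the case `β = 1`, which exceeds every `βs k`.
    · exact (hβs k).exists_decay (hβs k).2.1 le_rfl hc hD (by simpa only [Real.rpow_one] using h)
    · exact (hμ k).exists_decay (h (k + 2) (by omega))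
  have hX : (xChain g μ).IsFrechetChain := xChain.isFrechetChain hC hμ_zero hpos hmono
  obtain ⟨U, hUf, hU⟩ := exists_isFBounded_analysis hC hCg hU₀ hpos hdecay
  obtain ⟨T, hTc, hT⟩ := exists_isFBounded_synthesis hC hT₀ hμ_zero hpos hdecay
  obtain ⟨R, hRf, hR⟩ := exists_isFBounded_frameOperator_symm hC hCg hU₀ hT₀ hS₀ hpos hdecay
  have hUn (f : (xChain g μ).Lim) (n : ℕ) : (thetaChain μ).incl (U f) n =
      inner ℂ ((xChain g μ).incl (e n)) ((xChain g μ).incl f) := congrFun (hUf f) n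
  have hTU (f : (xChain g μ).Lim) : (xChain g μ).incl (T (U f)) = S₀ ((xChain g μ).incl f) := by
    rw [hTc, hS₀]
    congr 1
    ext n
    rw [thetaChain.toEllTwo_apply, hμ_zero, hUn, hU₀]
    simp
  have hTδ (n : ℕ) : T (thetaChain.delta μ n) = e n := by
    apply (xChain g μ).incl_injective
    rw [hTc, thetaChain.toEllTwo_delta, hμ_zero, Complex.ofReal_one, one_smul, hT₀]
  -- The two pairs behind everything below: `(U, R T)` for `e` and `(U R, T)` for its canonical
  -- dual.
  have hRTU (f : (xChain g μ).Lim) : (R ∘ₗ T) (U f) = f := by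
    apply (xChain g μ).incl_injective
    rw [LinearMap.comp_apply, hRf, hTU, S₀.symm_apply_apply]
  have hTUR (f : (xChain g μ).Lim) : T ((U ∘ₗ R) f) = f := by
    apply (xChain g μ).incl_injective
    rw [LinearMap.comp_apply, hTU, hRf, S₀.apply_symm_apply]
  have hURn (f : (xChain g μ).Lim) (n : ℕ) : (thetaChain μ).incl ((U ∘ₗ R) f) n =
      inner ℂ ((xChain g μ).incl (R (e n))) ((xChain g μ).incl f) := by
    rw [LinearMap.comp_apply, hUn, hRf, hRf, hself]
  have hRTδ (n : ℕ) : (R ∘ₗ T) (thetaChain.delta μ n) = R (e n) := by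
    rw [LinearMap.comp_apply, hTδ]
  have hRT : IsFBounded (R ∘ₗ T) := hR.comp hT
  have hUR : IsFBounded (U ∘ₗ R) := hU.comp hR
  have hmemU (f : (xChain g μ).Lim) :
      (fun n => inner ℂ ((xChain g μ).incl (e n)) ((xChain g μ).incl f)) ∈
        (thetaChain μ).inter := by
    rw [← show _ = _ from funext (hUn f)]; exact (U f).2
  have hmemUR (f : (xChain g μ).Lim) :
      (fun n => inner ℂ ((xChain g μ).incl (R (e n))) ((xChain g μ).incl f)) ∈
        (thetaChain μ).inter := by
    rw [← show _ = _ from funext (hURn f)]; exact ((U ∘ₗ R) f).2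
  obtain ⟨φ, hφ⟩ := hU.exists_functionals hμ_zero
  obtain ⟨φ', hφ'⟩ := hUR.exists_functionals hμ_zero
  -- an `f ∈ H` with coefficients in `Θ_F` is recovered by the synthesis operator
  have hrec (f : H) (hf : coeffMap (fun n => (xChain g μ).incl (e n)) f ∈ (thetaChain μ).inter) :
      ∃ x : (xChain g μ).Lim, (xChain g μ).incl x = f := by
    obtain ⟨c, hc⟩ := (thetaChain μ).exists_incl_eq hf
    refine ⟨R (T c), ?_⟩
    rw [hRf, hTc, S₀.symm_apply_eq, hS₀]
    congr 1
    ext n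
    rw [thetaChain.toEllTwo_apply, hμ_zero, hc, hU₀]
    simp [coeffMap]
  refine ⟨fun n => R (e n), fun n => by rw [hRf, hdual], ⟨U, T, T ∘ₗ U, hUn, hU,
    fun c => ?_, hT, rfl, hT.comp hU, ⟨fun f f' h => ?_, fun f => ⟨R f, hTUR f⟩⟩, fun f => ?_⟩,
    fun f => ⟨?_, ?_, hmemUR f, hmemU f⟩, fun _ => ⟨fun f => ⟨fun hf => ?_, fun hf => ?_⟩,
      fun f => ⟨fun hf => ?_, fun hf => ?_⟩⟩, φ, φ',
    fun n f => by rw [hφ, hUn], fun n f => by rw [hφ', hURn],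
    isFrechetFrame_of_leftInverse hX hpos hmono hU hRT hRTU hφ,
    isFrechetFrame_of_leftInverse hX hpos hmono hUR hT hTUR hφ', fun G => ?_, fun a ha => ?_⟩
  · have h := (hT.hasSum_synthesis c).seriesTo
    simpa only [hTδ] using h
  · rw [← hRTU f, ← hRTU f', LinearMap.comp_apply, LinearMap.comp_apply]
    exact congrArg R h
  · have h := hT.hasSum_synthesis (U f)
    simp only [hTδ, hUn] at h
    exact h
  · have h := (hT.hasSum_synthesis ((U ∘ₗ R) f)).seriesTo
    rw [hTUR] at h
    simpa only [hTδ, hURn] using h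
  · have h := (hRT.hasSum_synthesis (U f)).seriesTo
    rw [hRTU] at h
    simpa only [hRTδ, hUn] using h
  · exact hmemU ⟨f, hf⟩
  · obtain ⟨x, rfl⟩ := hrec f hf
    exact x.2
  · exact hmemUR ⟨f, hf⟩
  -- Since `⟨f, ẽ_n⟩ = ⟨S₀⁻¹ f, e_n⟩`, the case of `e` puts `S₀⁻¹ f` in `X_F`, and `T U = S₀` brings
  -- it back to `f`.
  · obtain ⟨x, hx⟩ := hrec (S₀.symm f) (by
      have e1 : coeffMap (fun n => (xChain g μ).incl (e n)) (S₀.symm f) =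
          coeffMap (fun n => (xChain g μ).incl (R (e n))) f := by
        ext n
        change inner ℂ ((xChain g μ).incl (e n)) (S₀.symm f) =
          inner ℂ ((xChain g μ).incl (R (e n))) f
        rw [hRf, hself]
      rwa [e1])
    have : f = (xChain g μ).incl (T (U x)) := by rw [hTU, hx, S₀.apply_symm_apply]
    rw [this]
    exact (T (U x)).2
  · have h := seriesTo_functional_of_leftInverse hpos hmono hμ_zero hUR hT hTUR hφ' G
    have h' := seriesTo_functional_of_leftInverse hpos hmono hμ_zero hU hRT hRTU hφ G
    simp only [hTδ] at h
    simp only [hRTδ] at h'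
    exact ⟨h.1, h'.1, h.2, h'.2⟩
  · obtain ⟨F, hF, hFf⟩ := exists_functional_of_memDual hpos hmono hμ_zero hU hφ ha
    obtain ⟨F', hF', hFf'⟩ := exists_functional_of_memDual hpos hmono hμ_zero hUR hφ' ha
    refine ⟨⟨F, hF, fun f => ?_⟩, ⟨F', hF', fun f => ?_⟩⟩
    · simpa only [hφ, hUn] using hFf f
    · simpa only [hφ', hURn] using hFf' f
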